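/- Conventions. Let $S$ be a semigroup; $1=S\times S$ and $0$ (equality) denote its total and trivial congruence. For congruences $\alpha_1,\dots,\alpha_n$ of $S$ ($n\ge 1$), let $M(\alpha_1,\dots,\alpha_n)$ be the subsemigroup of $S^{2^{n-1}\times 2}$ (entrywise multiplication; rows indexed by $\{0,1\}^{n-1}$, columns by $\{0,1\}$) generated by the following arrays: for $i<n$ and $(a,b)\in\alpha_i$, the array whose entries in row $r$ are both $a$ if $r_i=0$ and both $b$ if $r_i=1$; and for $(a,b)\in\alpha_n$, the array all of whose rows are $(a,b)$. The commutator $[\alpha_1,\dots,\alpha_n]$ is the smallest congruence $\delta$ such that for every $x\in M(\alpha_1,\dots,\alpha_n)$: if the two entries of $x$ in each row $r\neq(1,\dots,1)$ are $\delta$-related, then so are the two entries in row $(1,\dots,1)$. For $d\ge 0$, $S$ is $d$-solvable if $[1]^d=0$, where $[1]^0=1$ and $[1]^{i+1}=[[1]^i,[1]^i]$; left $d$-nilpotent if $[1,[1,\dots,[1,1]\dots]]=0$ ($d+1$ arguments, nested to the right as displayed); right $d$-nilpotent if $[\dots[[1,1],1],\dots,1]=0$ ($d+1$ arguments); $d$-supernilpotent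 if the $(d+1)$-ary commutator $[1,\dots,1]$ is $0$. $S$ is solvable (left nilpotent, etc.) if it is so for some $d$. A group is $n$-solvable ($n$-nilpotent) if it is solvable (nilpotent) of class at most $n$ in the classical sense. $S^m$ is the set of all products of $m$ elements of $S$, $m\ge 1$. A semigroup is completely simple if it has no proper (nonempty, two-sided) ideals and contains an idempotent $e$ that is primitive (the only idempotent $f$ with $ef=fe=f$ is $f=e$). A subgroup of a semigroup is a subsemigroup that is a group. Theorem. Let $S$ be a semigroup with an ideal $K$ that is a completely simple semigroup. (1) $S$ is solvable if and only if $S^m\subseteq K$ for some $m\ge 1$ and all subgroups of $K$ are solvable. (2) The following are equivalent: (a) $S$ is left nilpotent; (b) $S$ is right nilpotent; (c) $S$ is supernilpotent; (d) $S^m\subseteq K$ for some $m\ge 1$ and all subgroups of $K$ are nilpotent. Moreover, the following class bounds hold for all integers $d,n\ge 0$ and $m\ge 1$. (3) If $S$ is $d$-solvable, then $S^{2^d}=K$ and all subgroups of $K$ are $d$-solvable. (4) If $S$ is left $d$-nilpotent or right $d$-nilpotent or $d$-supernilpotent, then $S^{d+1}=K$ and all subgroups of $K$ are $d$-nilpotent.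 (5) If $S^m=K$ and all subgroups of $K$ are $n$-solvable, then $S$ is $(\lceil\log_2 m\rceil+n+1)$-solvable. (6) If $S^m=K$ and all subgroups of $K$ are $n$-nilpotent, then $S$ is left and right $(2m+n)$-nilpotent and $(2m\cdot\max(n,1))$-supernilpotent. -/

import Mathlib

universe u

namespace TermCondition

section Commutators

variable {S : Type u} [Semigroup S]

/-- The subsemigroup `M(α, β)` of the semigroup of all `2 × 2` arrays over `S` (with entrywise
multiplication) generated by the arrays with rows `(a, a), (b, b)` for `(a, b) ∈ α` and the arrays
with rows `(c, d), (c, d)` for `(c, d) ∈ β`. -/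
def arrays (α β : Con S) : Subsemigroup (Fin 2 → Fin 2 → S) :=
  Subsemigroup.closure
    ({x | ∃ a b : S, α a b ∧ x = ![![a, a], ![b, b]]} ∪
      {x | ∃ c d : S, β c d ∧ x = ![![c, d], ![c, d]]})

/-- `α` centralizes `β` modulo `δ`. -/
def Centralizes (α β δ : Con S) : Prop :=
  ∀ x ∈ arrays α β, δ (x 0 0) (x 0 1) → δ (x 1 0) (x 1 1)

/-- The binary term condition commutator `[α, β]`: the smallest congruence `δ` such that `α`
centralizes `β` modulo `δ`. -/
def comm (α β : Con S) : Con S := sInf {δ | Centralizes α β δ}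

theorem isLeast_comm (α β : Con S) : IsLeast {δ | Centralizes α β δ} (comm α β) :=
  ⟨fun x hx h δ hδ => hδ x hx (h δ hδ), fun _ hδ => sInf_le hδ⟩

/-- The subsemigroup `M(α₁, …, αₙ₊₁)` of `S ^ (2ⁿ × 2)`. The `2ⁿ` rows are indexed by
`r : Fin n → Bool` and the two columns by `c : Bool`. The `i`-th kind of generators, `i ≤ n`, is
constant along the rows and its entry in row `r` is `a` or `b` according to the `i`-th coordinate
of `r`; the last kind has all its rows equal to `(a, b)`. -/
def cubes {n : ℕ} (α : Fin (n + 1) → Con S) : Subsemigroup ((Fin n → Bool) → Bool → S) :=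
  Subsemigroup.closure
    ({x | ∃ (i : Fin n) (a b : S), α i.castSucc a b ∧ x = fun r _ => if r i then b else a} ∪
      {x | ∃ a b : S, α (Fin.last n) a b ∧ x = fun _ c => if c then b else a})

/-- The higher term condition: whenever the two entries of every row but the last one (the row
`fun _ => true`) are `δ`-related, then so are those of the last row. -/
def HigherCentralizes {n : ℕ} (α : Fin (n + 1) → Con S) (δ : Con S) : Prop :=
  ∀ x ∈ cubes α, (∀ r : Fin n → Bool, r ≠ (fun _ => true) → δ (x r false) (x r true)) →
    δ (x (fun _ => true) false) (x (fun _ => true) true)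

/-- The higher commutator `[α₁, …, αₙ₊₁]`. -/
def higherComm {n : ℕ} (α : Fin (n + 1) → Con S) : Con S := sInf {δ | HigherCentralizes α δ}

theorem isLeast_higherComm {n : ℕ} (α : Fin (n + 1) → Con S) :
    IsLeast {δ | HigherCentralizes α δ} (higherComm α) :=
  ⟨fun x hx h δ hδ => hδ x hx fun r hr => h r hr δ hδ, fun _ hδ => sInf_le hδ⟩

/-- The series `[α]⁰ = α`, `[α]ᵈ⁺¹ = [[α]ᵈ, [α]ᵈ]`. -/
def derived (α : Con S) : ℕ → Con S
  | 0 => α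
  | d + 1 => comm (derived α d) (derived α d)

end Commutators

section Notions

variable (S : Type u) [Semigroup S]

/-- `leftSeries S d` is the left-nested commutator `(1]ᵈ⁺¹ = [1, [1, … [1, 1] … ]]` with `d + 1`
arguments. -/
def leftSeries : ℕ → Con S
  | 0 => ⊤
  | d + 1 => comm ⊤ (leftSeries d)

/-- `rightSeries S d` is the right-nested commutator `[1)ᵈ⁺¹ = [ … [1, 1], … , 1]` with `d + 1`
arguments. -/
def rightSeries : ℕ → Con S
  | 0 => ⊤
  | d + 1 => comm (rightSeries d) ⊤

/-- `S` is `d`-solvable: `[1]ᵈ = 0`. -/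
def SolvableOfClass (d : ℕ) : Prop := derived (⊤ : Con S) d = ⊥

/-- `S` is left `d`-nilpotent: `(1]ᵈ⁺¹ = 0`. -/
def LeftNilpotentOfClass (d : ℕ) : Prop := leftSeries S d = ⊥

/-- `S` is right `d`-nilpotent: `[1)ᵈ⁺¹ = 0`. -/
def RightNilpotentOfClass (d : ℕ) : Prop := rightSeries S d = ⊥

/-- `S` is `d`-supernilpotent: the `(d + 1)`-ary commutator `[1, …, 1]` is `0`. -/
def SupernilpotentOfClass (d : ℕ) : Prop :=
  higherComm (fun _ : Fin (d + 1) => (⊤ : Con S)) = ⊥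

def Solvable : Prop := ∃ d, SolvableOfClass S d

def LeftNilpotent : Prop := ∃ d, LeftNilpotentOfClass S d

def RightNilpotent : Prop := ∃ d, RightNilpotentOfClass S d

def Supernilpotent : Prop := ∃ d, SupernilpotentOfClass S d

/-- `power S m` is the set `Sᵐ` of all products of `m` elements of `S`, for `m ≥ 1`
(the value at `m = 0` is a convention that is never used). -/
def power : ℕ → Set S
  | 0 => Set.univ
  | 1 => Set.univ
  | m + 2 => {x | ∃ a ∈ power (m + 1), ∃ b : S, x = a * b}

variable {S}

/-- A (nonempty, two-sided) ideal of a semigroup. -/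
def IsIdeal (I : Set S) : Prop :=
  I.Nonempty ∧ ∀ s : S, ∀ x ∈ I, s * x ∈ I ∧ x * s ∈ I

/-- An idempotent that is minimal for the order `f ≤ e ↔ e * f = f * e = f` on idempotents. -/
def IsPrimitiveIdempotent (e : S) : Prop :=
  IsIdempotentElem e ∧ ∀ f : S, IsIdempotentElem f → e * f = f → f * e = f → f = e

variable (S) in
/-- A semigroup is completely simple if it has no proper ideals and contains a primitive
idempotent. -/
def IsCompletelySimple : Prop :=
  (∀ I : Set S, IsIdeal I → I = Set.univ) ∧ ∃ e : S, IsPrimitiveIdempotent e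

/-- `S` is a nilpotent extension of `K`: `Sᵐ ⊆ K` for some `m ≥ 1`. -/
def IsNilpotentExtension (K : Subsemigroup S) : Prop :=
  ∃ m : ℕ, 1 ≤ m ∧ power S m ⊆ K

/-- All subgroups of `K` (subsemigroups of `K` that are groups) have the isomorphism invariant
property `P` of groups. A subgroup of `K` is given as an abstract group `G` together with an
injective multiplicative map onto it. -/
def SubgroupsSatisfy (K : Subsemigroup S) (P : ∀ (G : Type u) [Group G], Prop) : Prop :=
  ∀ (G : Type u) [Group G] (f : G →ₙ* S), Function.Injective f → Set.range f ⊆ K → P G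

end Notions

end TermCondition

/-! Fix a primitive idempotent e of K. Elements of K have Rees coordinates: an R-class, recorded by
`ρ a`; an element `γ a` of the maximal subgroup G = eSe; an L-class, recorded by `lam a`. Right
multiplication leaves the R-class of an element of K alone and left multiplication leaves its
L-class alone; each translation multiplies the group coordinate on its own side.

From S to K: suppose a and b are α- and β-related to elements of K. A suitable idempotent e of K
gives that ae is α-related to a and b is β-related to eb, while (ae)b = (ae)(eb); the term condition
then relates ab to aeb, which is in K, modulo [α, β] (`Absorbs.comm`). Iterating along a series that
reaches 0 puts a power of S inside K. In a subgroup, the term condition forces [α, β] to contain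
group commutators (`comm_map_commutator`). The supernilpotent case uses the same two devices, one
coordinate of the cube at a time.

From K to S: an upper bound on a commutator comes from a relation on arrays that contains the
generators, survives products and implies the term condition (`comm_le_of_invariant`). The series
first descends through Rees congruences of powers of S until these lie in K. Next the R- and
L-classes are fixed: one commutator suffices for solvability, whereas the nilpotent series lose one
translation per step (`transCon`). What is left lives in the group coordinate and follows the
derived or lower central series of G (`subgroupCon`).

For supernilpotence, the entries of an array are the values of one word at the vertices of a cube.
If products of m elements lie in K, the first m letters fix the R-class and the last m the L-class,
and so few letters miss a row coordinate. The group coordinate is a product of functions of at most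
2m coordinates each, hence a Host–Kra cube for the lower central filtration slowed down by the
factor 2m. Such a cube, trivial at all vertices but one, has its last value deep in the filtration.
-/

namespace TermCondition

/-! ### Rees coordinates on the completely simple ideal. -/

section Frames

/-- A coordinatization of the completely simple ideal `K` by a maximal subgroup: `ι` embeds the
group `G` onto `eSe`, where `e = ι 1`, and `γ a` is the element of `G` that represents `eae`. -/
structure Frame {S : Type u} [Semigroup S] (K : Subsemigroup S) (G : Type u) [Group G] where
  ι : G →ₙ* S
  γ : S → G
  mul_mem_left : ∀ (s : S) {x : S}, x ∈ K → s * x ∈ K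
  mul_mem_right : ∀ (s : S) {x : S}, x ∈ K → x * s ∈ K
  ι_injective : Function.Injective ι
  ι_mem : ∀ g, ι g ∈ K
  ι_γ : ∀ a, ι (γ a) = ι 1 * a * ι 1
  regular : ∀ {x : S}, x ∈ K → x * ι (γ x)⁻¹ * x = x

section Existence

theorem IsCompletelySimple.exists_eq_mul_mul {T : Type u} [Semigroup T]
    (h : IsCompletelySimple T) (x y : T) : ∃ a b : T, y = a * x * b := by
  have hI : IsIdeal {y : T | ∃ a b : T, y = a * x * b} := by
    refine ⟨⟨x * x * x, x, x, rfl⟩, ?_⟩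
    rintro s _ ⟨a, b, rfl⟩
    exact ⟨⟨s * a, b, by simp only [mul_assoc]⟩, ⟨a, b * s, by simp only [mul_assoc]⟩⟩
  have := h.1 _ hI
  exact (Set.eq_univ_iff_forall.1 this) y

/-- Simplicity gives e = axb with ae = a and eb = b. Then beax is an idempotent below e, so
primitivity makes it equal to e, and bea is the inverse sought. -/
theorem IsCompletelySimple.exists_left_inverse {T : Type u} [Semigroup T]
    (h : IsCompletelySimple T) {e : T} (he : IsPrimitiveIdempotent e) {x : T} (hx : e * x = x)
    (hx' : x * e = x) : ∃ y : T, e * y = y ∧ y * e = y ∧ y * x = e := by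
  obtain ⟨hee, hprim⟩ := he
  replace hee : e * e = e := hee
  obtain ⟨a, b, ha, hb, hab⟩ : ∃ a b : T, a * e = a ∧ e * b = b ∧ a * x * b = e := by
    obtain ⟨a, b, hab⟩ := h.exists_eq_mul_mul x e
    refine ⟨a * e, e * b, by rw [mul_assoc, hee], by rw [← mul_assoc, hee], ?_⟩
    rw [mul_assoc a, hx, ← mul_assoc, mul_assoc a, hx', ← hab]
  have ha' : a * x * b * a = e * a := by rw [hab]
  have key : e * (b * (e * a) * x) = b * (e * a) * x := by
    rw [← mul_assoc, ← mul_assoc, hb]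
  have hidem : b * (e * a) * x * (b * (e * a) * x) = b * (e * a) * x := by
    calc _ = b * (e * (a * x * b) * (e * a)) * x := by simp only [mul_assoc]
      _ = b * (e * a) * x := by rw [hab, hee, ← mul_assoc e e, hee]
  refine ⟨b * (e * a), by rw [← mul_assoc, hb], by rw [mul_assoc, mul_assoc, ha],
    hprim _ hidem key (by rw [mul_assoc, hx'])⟩

/-- The group structure of the local monoid `eSe` when all its elements have left inverses. -/
noncomputable abbrev cornerGroup {S : Type u} [Semigroup S] (e : S) (he : e * e = e)
    (hinv : ∀ x : S, e * x = x → x * e = x → ∃ y : S, e * y = y ∧ y * e = y ∧ y * x = e) :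
    Group {x : S // e * x = x ∧ x * e = x} :=
  letI : Mul {x : S // e * x = x ∧ x * e = x} :=
    ⟨fun x y => ⟨x.1 * y.1, by rw [← mul_assoc, x.2.1], by rw [mul_assoc, y.2.2]⟩⟩
  letI : One {x : S // e * x = x ∧ x * e = x} := ⟨⟨e, he, he⟩⟩
  letI : Inv {x : S // e * x = x ∧ x * e = x} :=
    ⟨fun x => ⟨(hinv x.1 x.2.1 x.2.2).choose, (hinv x.1 x.2.1 x.2.2).choose_spec.1,
      (hinv x.1 x.2.1 x.2.2).choose_spec.2.1⟩⟩
  Group.ofLeftAxioms (fun x y z => Subtype.ext (mul_assoc x.1 y.1 z.1))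
    (fun x => Subtype.ext x.2.1)
    (fun x => Subtype.ext (hinv x.1 x.2.1 x.2.2).choose_spec.2.2)

theorem exists_frame {S : Type u} [Semigroup S] (K : Subsemigroup S) (hK : IsIdeal (K : Set S))
    (hcs : IsCompletelySimple K) : ∃ (G : Type u) (_ : Group G), Nonempty (Frame K G) := by
  obtain ⟨e, he⟩ := hcs.2
  have hee : (e : S) * e = e := congrArg Subtype.val he.1
  have hl : ∀ (s : S) {x : S}, x ∈ K → s * x ∈ K := fun s x hx => (hK.2 s x hx).1
  have hr : ∀ (s : S) {x : S}, x ∈ K → x * s ∈ K := fun s x hx => (hK.2 s x hx).2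
  have hinv : ∀ x : S, (e : S) * x = x → x * e = x →
      ∃ y : S, (e : S) * y = y ∧ y * e = y ∧ y * x = e := by
    intro x h1 h2
    have hxK : x ∈ K := h1 ▸ hr x e.2
    obtain ⟨y, hy1, hy2, hy3⟩ := hcs.exists_left_inverse he (x := ⟨x, hxK⟩)
      (Subtype.ext h1) (Subtype.ext h2)
    exact ⟨y, congrArg Subtype.val hy1, congrArg Subtype.val hy2, congrArg Subtype.val hy3⟩
  let := cornerGroup (e : S) hee hinv
  let ι : {x : S // (e : S) * x = x ∧ x * e = x} →ₙ* S := ⟨Subtype.val, fun _ _ => rfl⟩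
  let γ : S → {x : S // (e : S) * x = x ∧ x * e = x} := fun a =>
    ⟨e * a * e, by rw [← mul_assoc, ← mul_assoc, hee], by rw [mul_assoc, hee]⟩
  have ι_one : ι 1 = e := rfl
  have ι_γ : ∀ a, ι (γ a) = e * a * e := fun a => rfl
  refine ⟨_, _, ⟨⟨ι, γ, hl, hr, Subtype.val_injective, ?_, fun a => rfl, ?_⟩⟩⟩
  · intro g
    have : ι g = e * ι g := g.2.1.symm
    rw [this]
    exact hr _ e.2
  · intro x hx
    -- Writing x = uev turns exe into the product of eue and eve in G, so the inverse of exe cancels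
    -- between v and u.
    obtain ⟨u, v, huv⟩ := hcs.exists_eq_mul_mul e ⟨x, hx⟩
    replace huv : x = u * e * v := congrArg Subtype.val huv
    have hγ : γ x = γ u * γ v := by
      apply Subtype.ext
      change (e : S) * x * e = e * u * e * (e * v * e)
      rw [huv]
      calc (e : S) * (u * e * v) * e = e * u * e * v * e := by simp only [mul_assoc]
        _ = e * u * (e * e) * v * e := by rw [hee]
        _ = _ := by simp only [mul_assoc]
    have hone : ι (γ v) * ι (γ x)⁻¹ * ι (γ u) = e := by
      rw [← map_mul, ← map_mul, hγ, mul_inv_rev, mul_inv_cancel_left, inv_mul_cancel, ι_one]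
    have hmid : (e : S) * v * ι (γ x)⁻¹ * u * e = e := by
      have h1 : (e : S) * ι (γ x)⁻¹ = ι (γ x)⁻¹ := (γ x)⁻¹.2.1
      have h2 : ι (γ x)⁻¹ * e = ι (γ x)⁻¹ := (γ x)⁻¹.2.2
      rw [ι_γ, ι_γ] at hone
      calc (e : S) * v * ι (γ x)⁻¹ * u * e = e * v * (e * ι (γ x)⁻¹ * e) * u * e := by rw [h1, h2]
        _ = e * v * e * ι (γ x)⁻¹ * (e * u * e) := by simp only [mul_assoc]
        _ = e := hone
    calc x * ι (γ x)⁻¹ * x = u * (e * v * ι (γ x)⁻¹ * u * e) * v := by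
          generalize ι (γ x)⁻¹ = w
          rw [huv]
          simp only [mul_assoc]
      _ = x := by rw [hmid, ← huv]

end Existence

namespace Frame

variable {S : Type u} [Semigroup S] {K : Subsemigroup S} {G : Type u} [Group G] (F : Frame K G)

theorem ι_one_mul (g : G) : F.ι 1 * F.ι g = F.ι g := by rw [← map_mul, one_mul]

theorem ι_mul_one (g : G) : F.ι g * F.ι 1 = F.ι g := by rw [← map_mul, mul_one]

theorem γ_ι_mul (g : G) (s : S) : F.γ (F.ι g * s) = g * F.γ s :=
  F.ι_injective <| by
    rw [map_mul, F.ι_γ, F.ι_γ]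
    simp only [← mul_assoc, ι_one_mul, ι_mul_one]

theorem γ_mul_ι (s : S) (g : G) : F.γ (s * F.ι g) = F.γ s * g :=
  F.ι_injective <| by
    rw [map_mul, F.ι_γ, F.ι_γ]
    simp only [mul_assoc, ι_one_mul, ι_mul_one]

theorem γ_mul_one_mul (s t : S) : F.γ (s * F.ι 1 * t) = F.γ s * F.γ t :=
  F.ι_injective <| by
    rw [map_mul, F.ι_γ, F.ι_γ, F.ι_γ]
    have : F.ι 1 = F.ι 1 * F.ι 1 := (F.ι_one_mul 1).symm
    calc F.ι 1 * (s * F.ι 1 * t) * F.ι 1 = F.ι 1 * s * F.ι 1 * t * F.ι 1 := by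
          simp only [mul_assoc]
      _ = F.ι 1 * s * (F.ι 1 * F.ι 1) * t * F.ι 1 := by rw [← this]
      _ = _ := by simp only [mul_assoc]

theorem γ_mul_ι_mul (s : S) (g : G) (t : S) : F.γ (s * F.ι g * t) = F.γ s * g * F.γ t := by
  rw [← F.γ_mul_ι, ← F.γ_mul_one_mul, mul_assoc s (F.ι g) (F.ι 1), ι_mul_one]

/-- The idempotent that is `R`-related to `a ∈ K` and `L`-related to `ι 1`. -/
def ρ (a : S) : S := a * F.ι (F.γ a)⁻¹

/-- The idempotent that is `L`-related to `a ∈ K` and `R`-related to `ι 1`. -/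
def lam (a : S) : S := F.ι (F.γ a)⁻¹ * a

theorem ρ_mem (a : S) : F.ρ a ∈ K := F.mul_mem_left _ (F.ι_mem _)

theorem lam_mem (a : S) : F.lam a ∈ K := F.mul_mem_right _ (F.ι_mem _)

theorem ρ_mul_self {a : S} (ha : a ∈ K) : F.ρ a * a = a := F.regular ha

theorem self_mul_lam {a : S} (ha : a ∈ K) : a * F.lam a = a := by
  rw [lam, ← mul_assoc, F.regular ha]

theorem coords {a : S} (ha : a ∈ K) : F.ρ a * F.ι (F.γ a) * F.lam a = a := by
  rw [ρ, lam, mul_assoc a, ← map_mul, mul_assoc, ← mul_assoc (F.ι _) (F.ι _), ← map_mul,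
    ← mul_assoc]
  simpa using F.regular ha

theorem ext {a b : S} (ha : a ∈ K) (hb : b ∈ K) (h1 : F.ρ a = F.ρ b) (h2 : F.lam a = F.lam b)
    (h3 : F.γ a = F.γ b) : a = b := by
  rw [← F.coords ha, ← F.coords hb, h1, h2, h3]

/-- Regularity replaces z by z (eze)⁻¹ z, which cuts the product at a group element. This is what
splits long words into short ones in the supernilpotent bound. -/
theorem γ_mul_mul (y : S) {z : S} (hz : z ∈ K) (w : S) :
    F.γ (y * z * w) = F.γ (y * z) * (F.γ z)⁻¹ * F.γ (z * w) := by
  rw [← F.γ_mul_ι_mul]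
  congr 1
  nth_rw 1 [← F.regular hz]
  simp only [mul_assoc]

theorem ρ_mul {a : S} (ha : a ∈ K) (x : S) : F.ρ (a * x) = F.ρ a := by
  have h : F.γ (F.ι (F.γ a)⁻¹ * (a * x)) = (F.γ a)⁻¹ * F.γ (a * x) := F.γ_ι_mul _ _
  have h1 : F.ι (F.γ a)⁻¹ * (a * x) * F.ι (F.γ (a * x))⁻¹ = F.ι (F.γ a)⁻¹ := by
    calc F.ι (F.γ a)⁻¹ * (a * x) * F.ι (F.γ (a * x))⁻¹
        = F.ι 1 * (F.ι (F.γ a)⁻¹ * (a * x)) * F.ι 1 * F.ι (F.γ (a * x))⁻¹ := by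
          rw [mul_assoc _ (F.ι 1), ι_one_mul, ← mul_assoc (F.ι 1), ι_one_mul]
      _ = F.ι (F.γ a)⁻¹ := by
          rw [← F.ι_γ, h, ← map_mul, mul_inv_cancel_right]
  calc F.ρ (a * x) = (F.ρ a * a) * x * F.ι (F.γ (a * x))⁻¹ := by rw [F.ρ_mul_self ha, ρ]
    _ = a * (F.ι (F.γ a)⁻¹ * (a * x) * F.ι (F.γ (a * x))⁻¹) := by
        simp only [ρ, mul_assoc]
    _ = F.ρ a := by rw [h1, ρ]

theorem lam_mul (x : S) {a : S} (ha : a ∈ K) : F.lam (x * a) = F.lam a := by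
  have h : F.γ ((x * a) * F.ι (F.γ a)⁻¹) = F.γ (x * a) * (F.γ a)⁻¹ := F.γ_mul_ι _ _
  have h1 : F.ι (F.γ (x * a))⁻¹ * ((x * a) * F.ι (F.γ a)⁻¹) = F.ι (F.γ a)⁻¹ := by
    calc F.ι (F.γ (x * a))⁻¹ * ((x * a) * F.ι (F.γ a)⁻¹)
        = F.ι (F.γ (x * a))⁻¹ * (F.ι 1 * ((x * a) * F.ι (F.γ a)⁻¹) * F.ι 1) := by
          rw [mul_assoc (F.ι 1), mul_assoc (x * a), ι_mul_one, ← mul_assoc _ (F.ι 1), ι_mul_one]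
      _ = F.ι (F.γ a)⁻¹ := by
          rw [← F.ι_γ, h, ← map_mul, inv_mul_cancel_left]
  calc F.lam (x * a) = F.ι (F.γ (x * a))⁻¹ * (x * (a * F.lam a)) := by
        rw [F.self_mul_lam ha, lam]
    _ = F.ι (F.γ (x * a))⁻¹ * ((x * a) * F.ι (F.γ a)⁻¹) * a := by
        simp only [lam, mul_assoc]
    _ = F.lam a := by rw [h1, lam]

theorem ρ_mul_ρ (s : S) {a : S} (ha : a ∈ K) : F.ρ (s * F.ρ a) = F.ρ (s * a) := by
  conv_rhs => rw [← F.ρ_mul_self ha, ← mul_assoc, F.ρ_mul (F.mul_mem_left s (F.ρ_mem a))]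

theorem lam_lam_mul {a : S} (ha : a ∈ K) (s : S) : F.lam (F.lam a * s) = F.lam (a * s) := by
  conv_rhs => rw [← F.self_mul_lam ha, mul_assoc, F.lam_mul _ (F.mul_mem_right s (F.lam_mem a))]

/-- The factor contributed by s depends on a only through its R-class, so elements of one R-class
are moved by the same group element. -/
theorem γ_mul_left (s : S) {a : S} (ha : a ∈ K) : F.γ (s * a) = F.γ (s * F.ρ a) * F.γ a := by
  nth_rw 1 [← F.regular ha]
  rw [← mul_assoc, ← mul_assoc, F.γ_mul_ι_mul, ρ, ← mul_assoc, F.γ_mul_ι]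

theorem γ_mul_right {a : S} (ha : a ∈ K) (s : S) : F.γ (a * s) = F.γ a * F.γ (F.lam a * s) := by
  nth_rw 1 [← F.regular ha]
  rw [mul_assoc _ a, F.γ_mul_ι_mul, lam, mul_assoc (F.ι _), F.γ_ι_mul, mul_assoc]

/-- The H-class where the L-class of k meets the R-class of k' is a group; e is its identity. In the
formula for e, g is the corresponding entry of the sandwich matrix. -/
theorem exists_idempotent (F : Frame K G) {k k' : S} (hk : k ∈ K) (hk' : k' ∈ K) :
    ∃ e ∈ K, e * e = e ∧ k * e = k ∧ e * k' = k' := by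
  have hmid : F.lam k * F.ρ k' = F.ι (F.γ (F.lam k * F.ρ k')) := by
    rw [F.ι_γ, lam, ρ, ← mul_assoc (F.ι 1), ← mul_assoc (F.ι 1), ι_one_mul, mul_assoc _ _ (F.ι 1),
      mul_assoc k' _ (F.ι 1), ι_mul_one]
  generalize F.γ (F.lam k * F.ρ k') = g at hmid
  have h1 : k * (F.ρ k' * F.ι g⁻¹ * F.lam k) = k := by
    calc k * (F.ρ k' * F.ι g⁻¹ * F.lam k)
        = k * F.lam k * (F.ρ k' * F.ι g⁻¹ * F.lam k) := by rw [F.self_mul_lam hk]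
      _ = k * ((F.lam k * F.ρ k') * F.ι g⁻¹) * F.lam k := by simp only [mul_assoc]
      _ = k * F.ι 1 * F.lam k := by rw [hmid, ← map_mul, mul_inv_cancel]
      _ = k := by rw [mul_assoc, lam, ← mul_assoc (F.ι 1), ι_one_mul, ← lam, F.self_mul_lam hk]
  have h2 : F.ρ k' * F.ι g⁻¹ * F.lam k * F.ρ k' = F.ρ k' := by
    rw [mul_assoc, hmid, mul_assoc, ← map_mul, inv_mul_cancel, ρ, mul_assoc, ι_mul_one]
  refine ⟨_, F.mul_mem_left _ (F.lam_mem k), ?_, h1, ?_⟩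
  · rw [← mul_assoc, ← mul_assoc, h2]
  · have h3 := congrArg (· * k') h2
    simp only [mul_assoc (_ * F.lam k), F.ρ_mul_self hk'] at h3
    exact h3

end Frame

end Frames

/-! ### The binary commutator and Rees congruences. -/

section BinaryCommutator

variable {S : Type u} [Semigroup S]

theorem arrays_mono {α α' β β' : Con S} (hα : α ≤ α') (hβ : β ≤ β') :
    arrays α β ≤ arrays α' β' := by
  apply Subsemigroup.closure_mono
  rintro x (⟨a, b, h, rfl⟩ | ⟨a, b, h, rfl⟩)
  · exact Or.inl ⟨a, b, hα h, rfl⟩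
  · exact Or.inr ⟨a, b, hβ h, rfl⟩

theorem comm_mono {α α' β β' : Con S} (hα : α ≤ α') (hβ : β ≤ β') : comm α β ≤ comm α' β' :=
  sInf_le_sInf fun _ hδ x hx h => hδ x (arrays_mono hα hβ hx) h

theorem arrays_induction {α β : Con S} (P : S → S → S → S → Prop)
    (row : ∀ a b, α a b → P a a b b) (col : ∀ c d, β c d → P c d c d)
    (mul : ∀ a b c d a' b' c' d', P a b c d → P a' b' c' d' →
      P (a * a') (b * b') (c * c') (d * d')) {x : Fin 2 → Fin 2 → S} (hx : x ∈ arrays α β) :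
    P (x 0 0) (x 0 1) (x 1 0) (x 1 1) := by
  induction hx using Subsemigroup.closure_induction with
  | mem x hx =>
    rcases hx with ⟨a, b, h, rfl⟩ | ⟨a, b, h, rfl⟩
    · exact row a b h
    · exact col a b h
  | mul x y _ _ hx hy => exact mul _ _ _ _ _ _ _ _ hx hy

/-- The invariant may be larger than the subsemigroup of arrays, which never has to be described
exactly. -/
theorem comm_le_of_invariant {α β δ : Con S} (P : S → S → S → S → Prop)
    (row : ∀ a b, α a b → P a a b b) (col : ∀ c d, β c d → P c d c d)
    (mul : ∀ a b c d a' b' c' d', P a b c d → P a' b' c' d' →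
      P (a * a') (b * b') (c * c') (d * d'))
    (h : ∀ a b c d, P a b c d → δ a b → δ c d) : comm α β ≤ δ :=
  sInf_le fun _ hx => h _ _ _ _ (arrays_induction P row col mul hx)

theorem comm_le_right (α β : Con S) : comm α β ≤ β :=
  comm_le_of_invariant (fun _ _ c d => β c d) (fun _ b _ => β.refl b) (fun _ _ h => h)
    (fun _ _ _ _ _ _ _ _ h h' => β.mul h h') (fun _ _ _ _ h _ => h)

theorem comm_le_left (α β : Con S) : comm α β ≤ α :=
  comm_le_of_invariant (fun a b c d => α a c ∧ α b d) (fun _ _ h => ⟨h, h⟩)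
    (fun c d _ => ⟨α.refl c, α.refl d⟩)
    (fun _ _ _ _ _ _ _ _ h h' => ⟨α.mul h.1 h'.1, α.mul h.2 h'.2⟩)
    (fun _ _ _ _ h h' => α.trans (α.symm h.1) (α.trans h' h.2))

/-- The term condition for a product of two elements: the array with rows `(p q, p q')` and
`(p' q, p' q')` belongs to `M(α, β)`. -/
theorem comm_mul_mul {α β : Con S} {p p' q q' : S} (hp : α p p') (hq : β q q')
    (h : p * q = p * q') : comm α β (p' * q) (p' * q') := by
  have h1 : (![![p, p], ![p', p']] : Fin 2 → Fin 2 → S) ∈ arrays α β :=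
    Subsemigroup.subset_closure (Or.inl ⟨p, p', hp, rfl⟩)
  have h2 : (![![q, q'], ![q, q']] : Fin 2 → Fin 2 → S) ∈ arrays α β :=
    Subsemigroup.subset_closure (Or.inr ⟨q, q', hq, rfl⟩)
  refine (isLeast_comm α β).1 _ (mul_mem h1 h2) ?_
  change comm α β (p * q) (p * q')
  rw [h]
  exact (comm α β).refl _

/-- The Rees congruence of an ideal. -/
def reesCon (I : Set S) (hI : ∀ s : S, ∀ x ∈ I, s * x ∈ I ∧ x * s ∈ I) : Con S where
  r x y := x = y ∨ (x ∈ I ∧ y ∈ I)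
  iseqv :=
    { refl := fun _ => Or.inl rfl
      symm := by
        rintro x y (rfl | h)
        exacts [Or.inl rfl, Or.inr h.symm]
      trans := by
        rintro x y z (rfl | h) (rfl | h')
        exacts [Or.inl rfl, Or.inr h', Or.inr h, Or.inr ⟨h.1, h'.2⟩] }
  mul' := by
    rintro w x y z (rfl | h) (rfl | h')
    exacts [Or.inl rfl, Or.inr ⟨(hI _ _ h'.1).1, (hI _ _ h'.2).1⟩,
      Or.inr ⟨(hI _ _ h.1).2, (hI _ _ h.2).2⟩, Or.inr ⟨(hI _ _ h'.1).1, (hI _ _ h'.2).1⟩]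

/-- Every array either has equal entries in each row, or has equal rows with entries in B, or lies
entirely in T: a product that mixes a row change in A with a column change in B falls into T. -/
theorem comm_reesCon_le {A B T : Set S} (hA : ∀ s : S, ∀ x ∈ A, s * x ∈ A ∧ x * s ∈ A)
    (hB : ∀ s : S, ∀ x ∈ B, s * x ∈ B ∧ x * s ∈ B)
    (hT : ∀ s : S, ∀ x ∈ T, s * x ∈ T ∧ x * s ∈ T)
    (hAB : ∀ a ∈ A, ∀ b ∈ B, a * b ∈ T ∧ b * a ∈ T) :
    comm (reesCon A hA) (reesCon B hB) ≤ reesCon T hT := by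
  refine comm_le_of_invariant
    (fun a b c d => (a = b ∧ c = d ∧ (a = c ∨ a ∈ A ∧ c ∈ A)) ∨
      (a = c ∧ b = d ∧ a ∈ B ∧ b ∈ B) ∨ (a ∈ T ∧ b ∈ T ∧ c ∈ T ∧ d ∈ T)) ?_ ?_ ?_ ?_
  · intro a b h
    exact Or.inl ⟨rfl, rfl, h⟩
  · rintro c d (rfl | h)
    · exact Or.inl ⟨rfl, rfl, Or.inl rfl⟩
    · exact Or.inr (Or.inl ⟨rfl, rfl, h⟩)
  · rintro a b c d a' b' c' d' (⟨rfl, rfl, h⟩ | ⟨rfl, rfl, h⟩ | h) h'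
    · rcases h' with ⟨rfl, rfl, h'⟩ | ⟨rfl, rfl, h'⟩ | h'
      · exact Or.inl ⟨rfl, rfl, (reesCon A hA).mul h h'⟩
      · rcases h with rfl | h
        · exact Or.inr (Or.inl ⟨rfl, rfl, (hB _ _ h'.1).1, (hB _ _ h'.2).1⟩)
        · exact Or.inr (Or.inr ⟨(hAB _ h.1 _ h'.1).1, (hAB _ h.1 _ h'.2).1,
            (hAB _ h.2 _ h'.1).1, (hAB _ h.2 _ h'.2).1⟩)
      · exact Or.inr (Or.inr ⟨(hT _ _ h'.1).1, (hT _ _ h'.2.1).1, (hT _ _ h'.2.2.1).1,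
          (hT _ _ h'.2.2.2).1⟩)
    · rcases h' with ⟨rfl, rfl, rfl | h'⟩ | ⟨rfl, rfl, h'⟩ | h'
      · exact Or.inr (Or.inl ⟨rfl, rfl, (hB _ _ h.1).2, (hB _ _ h.2).2⟩)
      · exact Or.inr (Or.inr ⟨(hAB _ h'.1 _ h.1).2, (hAB _ h'.1 _ h.2).2,
            (hAB _ h'.2 _ h.1).2, (hAB _ h'.2 _ h.2).2⟩)
      · exact Or.inr (Or.inl ⟨rfl, rfl, (hB _ _ h.1).2, (hB _ _ h.2).2⟩)
      · exact Or.inr (Or.inr ⟨(hT _ _ h'.1).1, (hT _ _ h'.2.1).1, (hT _ _ h'.2.2.1).1,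
          (hT _ _ h'.2.2.2).1⟩)
    · exact Or.inr (Or.inr ⟨(hT _ _ h.1).2, (hT _ _ h.2.1).2, (hT _ _ h.2.2.1).2,
          (hT _ _ h.2.2.2).2⟩)
  · rintro a b c d (⟨rfl, rfl, -⟩ | ⟨rfl, rfl, -⟩ | h) hab
    · exact Or.inl rfl
    · exact hab
    · exact Or.inr h.2.2

end BinaryCommutator

/-! ### Powers of S along the commutator series. -/

section Powers

variable {S : Type u} [Semigroup S]

theorem power_mul_mem (i j : ℕ) {a b : S} (ha : a ∈ power S (i + 1)) (hb : b ∈ power S (j + 1)) :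
    a * b ∈ power S (i + j + 2) := by
  induction j generalizing b with
  | zero => exact ⟨a, ha, b, rfl⟩
  | succ j ih =>
    obtain ⟨b, hb, c, rfl⟩ := hb
    exact ⟨a * b, ih hb, c, (mul_assoc a b c).symm⟩

theorem power_ideal (m : ℕ) (s x : S) (hx : x ∈ power S m) :
    s * x ∈ power S m ∧ x * s ∈ power S m := by
  match m, hx with
  | 0, _ => exact ⟨trivial, trivial⟩
  | 1, _ => exact ⟨trivial, trivial⟩
  | m + 2, ⟨a, ha, b, hab⟩ =>
    subst hab
    exact ⟨⟨s * a, (power_ideal (m + 1) s a ha).1, b, (mul_assoc s a b).symm⟩,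
      ⟨a, ha, b * s, mul_assoc a b s⟩⟩

theorem power_antitone : Antitone (power S) := by
  refine antitone_nat_of_succ_le fun m => ?_
  match m with
  | 0 => exact fun _ _ => trivial
  | m + 1 =>
    rintro _ ⟨a, ha, b, rfl⟩
    exact (power_ideal (m + 1) b a ha).2

theorem Frame.subset_power {K : Subsemigroup S} {G : Type u} [Group G] (F : Frame K G) (m : ℕ) :
    (K : Set S) ⊆ power S m := by
  match m with
  | 0 => exact fun _ _ => trivial
  | 1 => exact fun _ _ => trivial
  | m + 2 =>
    intro k hk
    exact ⟨F.ρ k, F.subset_power (m + 1) (F.ρ_mem k), k, (F.ρ_mul_self hk).symm⟩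

theorem exists_mul_of_mem_power_add (i j : ℕ) {x : S} (hx : x ∈ power S (i + j + 2)) :
    ∃ a ∈ power S (i + 1), ∃ b ∈ power S (j + 1), x = a * b := by
  induction j generalizing x with
  | zero =>
    obtain ⟨a, ha, b, rfl⟩ := hx
    exact ⟨a, ha, b, trivial, rfl⟩
  | succ j ih =>
    obtain ⟨y, hy, c, rfl⟩ := hx
    obtain ⟨a, ha, b, hb, rfl⟩ := ih hy
    exact ⟨a, ha, b * c, ⟨b, hb, c, rfl⟩, mul_assoc a b c⟩

theorem comm_reesCon_power_le {α β : Con S} (i j : ℕ)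
    (hα : α ≤ reesCon (power S (i + 1)) (power_ideal _))
    (hβ : β ≤ reesCon (power S (j + 1)) (power_ideal _)) :
    comm α β ≤ reesCon (power S (i + j + 2)) (power_ideal _) :=
  (comm_mono hα hβ).trans <| comm_reesCon_le _ _ _ fun a ha b hb =>
    ⟨power_mul_mem i j ha hb, by
      have := power_mul_mem j i hb ha
      rwa [add_comm j i] at this⟩

theorem le_reesCon_power_one (α : Con S) :
    α ≤ reesCon (power S 1) (power_ideal _) :=
  fun _ => fun _ _ => Or.inr ⟨trivial, trivial⟩

theorem leftSeries_le_reesCon_power (i : ℕ) :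
    leftSeries S i ≤ reesCon (power S (i + 1)) (power_ideal _) := by
  induction i with
  | zero => exact le_reesCon_power_one _
  | succ i ih =>
    have := comm_reesCon_power_le 0 i (le_reesCon_power_one ⊤) ih
    rwa [zero_add] at this

theorem rightSeries_le_reesCon_power (i : ℕ) :
    rightSeries S i ≤ reesCon (power S (i + 1)) (power_ideal _) := by
  induction i with
  | zero => exact le_reesCon_power_one _
  | succ i ih => exact comm_reesCon_power_le i 0 ih (le_reesCon_power_one ⊤)

theorem derived_le_reesCon_power (i : ℕ) :
    derived (⊤ : Con S) i ≤ reesCon (power S (2 ^ i)) (power_ideal _) := by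
  induction i with
  | zero => exact le_reesCon_power_one _
  | succ i ih =>
    obtain ⟨k, hk⟩ : ∃ k, 2 ^ i = k + 1 := Nat.exists_eq_succ_of_ne_zero (by positivity)
    have h2 : 2 ^ (i + 1) = k + k + 2 := by rw [pow_succ, hk]; ring
    simp only [hk] at ih
    simp only [h2]
    exact comm_reesCon_power_le k k ih ih

/-- Every element of `I` is `α`-related to an element of `K`. -/
def Absorbs (K : Subsemigroup S) (α : Con S) (I : Set S) : Prop :=
  ∀ a ∈ I, ∃ k ∈ K, α a k

/-- The idempotent e with ke = k and ek' = k' makes ae α-related to a and b β-related to eb. As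
(ae)b = (ae)(eb), the term condition moves ab to aeb in K. -/
theorem Absorbs.comm {K : Subsemigroup S} {G : Type u} [Group G] (F : Frame K G) {α β : Con S}
    {i j : ℕ} (hα : Absorbs K α (power S (i + 1))) (hβ : Absorbs K β (power S (j + 1))) :
    Absorbs K (comm α β) (power S (i + j + 2)) := by
  intro x hx
  obtain ⟨a, ha, b, hb, rfl⟩ := exists_mul_of_mem_power_add i j hx
  obtain ⟨k, hk, hak⟩ := hα a ha
  obtain ⟨k', hk', hbk⟩ := hβ b hb
  obtain ⟨e, he, hee, hke, hek⟩ := F.exists_idempotent hk hk'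
  have h1 : α (a * e) a := by
    have := α.mul hak (α.refl e)
    rw [hke] at this
    exact α.trans this (α.symm hak)
  have h2 : β b (e * b) := by
    have := β.mul (β.refl e) hbk
    rw [hek] at this
    exact β.trans hbk (β.symm this)
  refine ⟨a * (e * b), F.mul_mem_left _ (F.mul_mem_right _ he), comm_mul_mul h1 h2 ?_⟩
  rw [mul_assoc, mul_assoc, ← mul_assoc e e, hee]

theorem absorbs_top {K : Subsemigroup S} {G : Type u} [Group G] (F : Frame K G) (I : Set S) :
    Absorbs K ⊤ I :=
  fun _ _ => ⟨F.ι 1, F.ι_mem 1, trivial⟩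

theorem Absorbs.subset {K : Subsemigroup S} {I : Set S} (h : Absorbs K ⊥ I) : I ⊆ K := by
  intro a ha
  obtain ⟨k, hk, hak⟩ := h a ha
  exact (show a = k from hak) ▸ hk

theorem absorbs_leftSeries {K : Subsemigroup S} {G : Type u} [Group G] (F : Frame K G) (i : ℕ) :
    Absorbs K (leftSeries S i) (power S (i + 1)) := by
  induction i with
  | zero => exact absorbs_top F _
  | succ i ih =>
    have := Absorbs.comm F (i := 0) (absorbs_top F _) ih
    rwa [zero_add] at this

theorem absorbs_rightSeries {K : Subsemigroup S} {G : Type u} [Group G] (F : Frame K G) (i : ℕ) :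
    Absorbs K (rightSeries S i) (power S (i + 1)) := by
  induction i with
  | zero => exact absorbs_top F _
  | succ i ih => exact Absorbs.comm F (j := 0) ih (absorbs_top F _)

theorem absorbs_derived {K : Subsemigroup S} {G : Type u} [Group G] (F : Frame K G) (i : ℕ) :
    Absorbs K (derived ⊤ i) (power S (2 ^ i)) := by
  induction i with
  | zero => exact absorbs_top F _
  | succ i ih =>
    obtain ⟨k, hk⟩ : ∃ k, 2 ^ i = k + 1 := Nat.exists_eq_succ_of_ne_zero (by positivity)
    have h2 : 2 ^ (i + 1) = k + k + 2 := by rw [pow_succ, hk]; ring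
    rw [hk] at ih
    rw [h2]
    exact Absorbs.comm F ih ih

end Powers

/-! ### Group commutators inside the term condition commutator. -/

section Subgroups

variable {S : Type u} [Semigroup S] {G : Type u} [Group G] (f : G →ₙ* S)

/-- The product of the arrays for a, b, a⁻¹, b⁻¹, with a varying along rows and b along columns, has
first row (1, 1) and second row ([a, b], 1), up to `f`. -/
theorem comm_map_commutator {α β : Con S} {A B : Subgroup G} (hA : ∀ a ∈ A, α (f a) (f 1))
    (hB : ∀ b ∈ B, β (f b) (f 1)) : ∀ g ∈ ⁅A, B⁆, comm α β (f g) (f 1) := by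
  intro g hg
  rw [Subgroup.commutator_def] at hg
  induction hg using Subgroup.closure_induction with
  | mem g hg =>
    obtain ⟨a, ha, b, hb, rfl⟩ := hg
    have row : ∀ a ∈ A, (![![f 1, f 1], ![f a, f a]] : Fin 2 → Fin 2 → S) ∈ arrays α β :=
      fun a ha => Subsemigroup.subset_closure (Or.inl ⟨_, _, α.symm (hA a ha), rfl⟩)
    have col : ∀ b ∈ B, (![![f b, f 1], ![f b, f 1]] : Fin 2 → Fin 2 → S) ∈ arrays α β :=
      fun b hb => Subsemigroup.subset_closure (Or.inr ⟨_, _, hB b hb, rfl⟩)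
    have key := (isLeast_comm α β).1 _ (mul_mem (mul_mem (mul_mem (row a ha) (col b hb))
      (row a⁻¹ (A.inv_mem ha))) (col b⁻¹ (B.inv_mem hb)))
    have h : comm α β (f 1 * f b * f 1 * f b⁻¹) (f 1 * f 1 * f 1 * f 1) →
      comm α β (f a * f b * f a⁻¹ * f b⁻¹) (f a * f 1 * f a⁻¹ * f 1) := key
    simp only [← map_mul, one_mul, mul_one, mul_inv_cancel] at h
    exact h ((comm α β).refl _)
  | one => exact (comm α β).refl _
  | mul x y _ _ hx hy =>
    have := (comm α β).mul hx hy
    rwa [← map_mul, ← map_mul, one_mul] at this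
  | inv x _ hx =>
    have := (comm α β).mul ((comm α β).refl (f x⁻¹)) hx
    rw [← map_mul, ← map_mul, inv_mul_cancel, mul_one] at this
    exact (comm α β).symm this

theorem derived_map_derivedSeries (d : ℕ) :
    ∀ g ∈ derivedSeries G d, derived (⊤ : Con S) d (f g) (f 1) := by
  induction d with
  | zero => exact fun _ _ => trivial
  | succ d ih => exact comm_map_commutator f ih ih

theorem leftSeries_map_lowerCentralSeries (d : ℕ) :
    ∀ g ∈ (⊤ : Subgroup G).lowerCentralSeries d, leftSeries S d (f g) (f 1) := by
  induction d with
  | zero => exact fun _ _ => trivial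
  | succ d ih =>
    rw [Subgroup.lowerCentralSeries_succ, Subgroup.commutator_comm]
    exact comm_map_commutator f (fun _ _ => trivial) ih

theorem rightSeries_map_lowerCentralSeries (d : ℕ) :
    ∀ g ∈ (⊤ : Subgroup G).lowerCentralSeries d, rightSeries S d (f g) (f 1) := by
  induction d with
  | zero => exact fun _ _ => trivial
  | succ d ih =>
    rw [Subgroup.lowerCentralSeries_succ]
    exact comm_map_commutator f ih (fun _ _ => trivial)

theorem eq_bot_of_forall_rel_bot {f : G →ₙ* S} (hf : Function.Injective f) {A : Subgroup G}
    (h : ∀ g ∈ A, (⊥ : Con S) (f g) (f 1)) : A = ⊥ :=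
  (Subgroup.eq_bot_iff_forall A).2 fun g hg => hf (h g hg)

end Subgroups

/-! ### Congruences on S that interpolate between the Rees congruence of K and equality. -/

section Congruences

/-- A congruence from an equivalence relation that is compatible with left and right
translations. -/
def conOfTranslations {S : Type u} [Semigroup S] (r : S → S → Prop) (hr : Equivalence r)
    (left : ∀ s a b, r a b → r (s * a) (s * b)) (right : ∀ s a b, r a b → r (a * s) (b * s)) :
    Con S where
  r := r
  iseqv := hr
  mul' h h' := hr.trans (right _ _ _ h) (left _ _ _ h')

namespace Frame

variable {S : Type u} [Semigroup S] {K : Subsemigroup S} {G : Type u} [Group G] (F : Frame K G)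

/-- `a` and `b` become `R`-related after multiplication by any `j` elements from the left. -/
def RRel : ℕ → S → S → Prop
  | 0, a, b => F.ρ a = F.ρ b
  | j + 1, a, b => ∀ s : S, RRel j (s * a) (s * b)

/-- `a` and `b` become `L`-related after multiplication by any `j` elements from the right. -/
def LRel : ℕ → S → S → Prop
  | 0, a, b => F.lam a = F.lam b
  | j + 1, a, b => ∀ s : S, LRel j (a * s) (b * s)

variable {F}

theorem RRel.refl (j : ℕ) (a : S) : F.RRel j a a := by
  induction j generalizing a with
  | zero => rfl
  | succ j ih => exact fun s => ih _

theorem LRel.refl (j : ℕ) (a : S) : F.LRel j a a := by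
  induction j generalizing a with
  | zero => rfl
  | succ j ih => exact fun s => ih _

theorem RRel.symm {j : ℕ} {a b : S} (h : F.RRel j a b) : F.RRel j b a := by
  induction j generalizing a b with
  | zero => exact Eq.symm h
  | succ j ih => exact fun s => ih (h s)

theorem LRel.symm {j : ℕ} {a b : S} (h : F.LRel j a b) : F.LRel j b a := by
  induction j generalizing a b with
  | zero => exact Eq.symm h
  | succ j ih => exact fun s => ih (h s)

theorem RRel.trans {j : ℕ} {a b c : S} (h : F.RRel j a b) (h' : F.RRel j b c) :
    F.RRel j a c := by
  induction j generalizing a b c with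
  | zero => exact Eq.trans h h'
  | succ j ih => exact fun s => ih (h s) (h' s)

theorem LRel.trans {j : ℕ} {a b c : S} (h : F.LRel j a b) (h' : F.LRel j b c) :
    F.LRel j a c := by
  induction j generalizing a b c with
  | zero => exact Eq.trans h h'
  | succ j ih => exact fun s => ih (h s) (h' s)

theorem RRel.mul_left {j : ℕ} {a b : S} (ha : a ∈ K) (hb : b ∈ K) (h : F.RRel j a b) (s : S) :
    F.RRel j (s * a) (s * b) := by
  cases j with
  | zero =>
    change F.ρ a = F.ρ b at h
    change F.ρ (s * a) = F.ρ (s * b)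
    rw [← F.ρ_mul_ρ s ha, h, F.ρ_mul_ρ s hb]
  | succ j =>
    intro t
    rw [← mul_assoc, ← mul_assoc]
    exact h _

theorem LRel.mul_right {j : ℕ} {a b : S} (ha : a ∈ K) (hb : b ∈ K) (h : F.LRel j a b) (s : S) :
    F.LRel j (a * s) (b * s) := by
  cases j with
  | zero =>
    change F.lam a = F.lam b at h
    change F.lam (a * s) = F.lam (b * s)
    rw [← F.lam_lam_mul ha, h, F.lam_lam_mul hb]
  | succ j =>
    intro t
    rw [mul_assoc, mul_assoc]
    exact h _

theorem RRel.succ {j : ℕ} {a b : S} (ha : a ∈ K) (hb : b ∈ K) (h : F.RRel j a b) :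
    F.RRel (j + 1) a b :=
  h.mul_left ha hb

theorem LRel.succ {j : ℕ} {a b : S} (ha : a ∈ K) (hb : b ∈ K) (h : F.LRel j a b) :
    F.LRel (j + 1) a b :=
  h.mul_right ha hb

theorem RRel.of_ρ_eq {a b : S} (ha : a ∈ K) (hb : b ∈ K) (h : F.ρ a = F.ρ b) (j : ℕ) :
    F.RRel j a b := by
  induction j with
  | zero => exact h
  | succ j ih => exact ih.succ ha hb

theorem LRel.of_lam_eq {a b : S} (ha : a ∈ K) (hb : b ∈ K) (h : F.lam a = F.lam b) (j : ℕ) :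
    F.LRel j a b := by
  induction j with
  | zero => exact h
  | succ j ih => exact ih.succ ha hb

theorem RRel.mul {j : ℕ} {a b : S} (ha : a ∈ K) (hb : b ∈ K) (h : F.RRel j a b) (x y : S) :
    F.RRel j (a * x) (b * y) :=
  (RRel.of_ρ_eq (F.mul_mem_right x ha) ha (F.ρ_mul ha x) j).trans <|
    h.trans (RRel.of_ρ_eq (F.mul_mem_right y hb) hb (F.ρ_mul hb y) j).symm

theorem LRel.mul {j : ℕ} {a b : S} (ha : a ∈ K) (hb : b ∈ K) (h : F.LRel j a b) (x y : S) :
    F.LRel j (x * a) (y * b) :=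
  (LRel.of_lam_eq (F.mul_mem_left x ha) ha (F.lam_mul x ha) j).trans <|
    h.trans (LRel.of_lam_eq (F.mul_mem_left y hb) hb (F.lam_mul y hb) j).symm

theorem RRel.of_power {m : ℕ} {a b : S} (h : ∀ w ∈ power S (m + 1), F.ρ (w * a) = F.ρ (w * b)) :
    F.RRel (m + 1) a b := by
  induction m generalizing a b with
  | zero => exact fun s => h s trivial
  | succ m ih =>
    refine fun s => ih fun w hw => ?_
    rw [← mul_assoc, ← mul_assoc]
    exact h _ ⟨w, hw, s, rfl⟩

theorem LRel.of_power {m : ℕ} {a b : S}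
    (h : ∀ w ∈ power S (m + 1), F.lam (a * w) = F.lam (b * w)) : F.LRel (m + 1) a b := by
  induction m generalizing a b with
  | zero => exact fun s => h s trivial
  | succ m ih =>
    refine fun s => ih fun w hw => ?_
    rw [mul_assoc, mul_assoc]
    have := power_mul_mem 0 m (a := s) trivial hw
    rw [zero_add] at this
    exact h _ this

variable (F)

/-- The congruence on `S` that relates the elements of `K` which become `R`-related (`L`-related)
after multiplication by any `j` elements from the left (right). -/
def transCon (j : ℕ) : Con S :=
  conOfTranslations (fun x y => x = y ∨ (x ∈ K ∧ y ∈ K ∧ F.RRel j x y ∧ F.LRel j x y))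
    { refl := fun _ => Or.inl rfl
      symm := by
        rintro x y (rfl | ⟨hx, hy, h1, h2⟩)
        exacts [Or.inl rfl, Or.inr ⟨hy, hx, h1.symm, h2.symm⟩]
      trans := by
        rintro x y z (rfl | ⟨hx, hy, h1, h2⟩) (rfl | ⟨hy', hz, h1', h2'⟩)
        exacts [Or.inl rfl, Or.inr ⟨hy', hz, h1', h2'⟩, Or.inr ⟨hx, hy, h1, h2⟩,
          Or.inr ⟨hx, hz, h1.trans h1', h2.trans h2'⟩] }
    (by
      rintro s a b (rfl | ⟨ha, hb, h1, h2⟩)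
      exacts [Or.inl rfl, Or.inr ⟨F.mul_mem_left _ ha, F.mul_mem_left _ hb,
        h1.mul_left ha hb s, h2.mul ha hb s s⟩])
    (by
      rintro s a b (rfl | ⟨ha, hb, h1, h2⟩)
      exacts [Or.inl rfl, Or.inr ⟨F.mul_mem_right _ ha, F.mul_mem_right _ hb,
        h1.mul ha hb s s, h2.mul_right ha hb s⟩])

variable {F}

theorem RRel.of_transCon {j : ℕ} {x y : S} (h : F.transCon j x y) : F.RRel j x y := by
  rcases h with rfl | h
  exacts [RRel.refl j x, h.2.2.1]

theorem LRel.of_transCon {j : ℕ} {x y : S} (h : F.transCon j x y) : F.LRel j x y := by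
  rcases h with rfl | h
  exacts [LRel.refl j x, h.2.2.2]

variable (F)

/-- A product w of m + 1 elements lies in K, so wx and wy both have the R-class of w, and dually on
the other side. -/
theorem reesCon_le_transCon {m : ℕ} (hm : power S (m + 1) ⊆ K) :
    reesCon (power S (m + 1)) (power_ideal _) ≤ F.transCon (m + 1) := by
  rintro x y (rfl | h)
  · exact Or.inl rfl
  · exact Or.inr ⟨hm h.1, hm h.2,
      RRel.of_power fun w hw => by rw [F.ρ_mul (hm hw), F.ρ_mul (hm hw)],
      LRel.of_power fun w hw => by rw [F.lam_mul _ (hm hw), F.lam_mul _ (hm hw)]⟩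

/-- While each column stays within one R-class, the relation between a and b passes to c and d. A
left factor that varies with the row destroys this, but it uses up one translation and so leaves c
and d related at level j outright. L-classes behave dually. -/
theorem comm_top_transCon_le (j : ℕ) : comm ⊤ (F.transCon (j + 1)) ≤ F.transCon j := by
  refine comm_le_of_invariant
    (fun a b c d => (a = b ∧ c = d) ∨ (a ∈ K ∧ b ∈ K ∧ c ∈ K ∧ d ∈ K ∧
      ((F.ρ a = F.ρ c ∧ F.ρ b = F.ρ d ∧ F.RRel (j + 1) c d) ∨ F.RRel j c d) ∧
      ((F.lam a = F.lam c ∧ F.lam b = F.lam d ∧ F.LRel (j + 1) c d) ∨ F.LRel j c d)))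
    ?_ ?_ ?_ ?_
  · intro a b _
    exact Or.inl ⟨rfl, rfl⟩
  · rintro c d (rfl | ⟨hc, hd, h1, h2⟩)
    · exact Or.inl ⟨rfl, rfl⟩
    · exact Or.inr ⟨hc, hd, hc, hd, Or.inl ⟨rfl, rfl, h1⟩, Or.inl ⟨rfl, rfl, h2⟩⟩
  · have hR : ∀ {a b c d x y z w : S}, a ∈ K → b ∈ K → c ∈ K → d ∈ K →
        ((F.ρ a = F.ρ c ∧ F.ρ b = F.ρ d ∧ F.RRel (j + 1) c d) ∨ F.RRel j c d) →
        ((F.ρ (a * x) = F.ρ (c * z) ∧ F.ρ (b * y) = F.ρ (d * w) ∧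
          F.RRel (j + 1) (c * z) (d * w)) ∨ F.RRel j (c * z) (d * w)) := by
      rintro a b c d x y z w ha hb hc hd (⟨h1, h2, h3⟩ | h)
      · refine Or.inl ⟨?_, ?_, h3.mul hc hd _ _⟩
        · rw [F.ρ_mul ha, F.ρ_mul hc, h1]
        · rw [F.ρ_mul hb, F.ρ_mul hd, h2]
      · exact Or.inr (h.mul hc hd _ _)
    have hL : ∀ {a b c d x y z w : S}, a ∈ K → b ∈ K → c ∈ K → d ∈ K →
        ((F.lam a = F.lam c ∧ F.lam b = F.lam d ∧ F.LRel (j + 1) c d) ∨ F.LRel j c d) →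
        ((F.lam (x * a) = F.lam (z * c) ∧ F.lam (y * b) = F.lam (w * d) ∧
          F.LRel (j + 1) (z * c) (w * d)) ∨ F.LRel j (z * c) (w * d)) := by
      rintro a b c d x y z w ha hb hc hd (⟨h1, h2, h3⟩ | h)
      · refine Or.inl ⟨?_, ?_, h3.mul hc hd _ _⟩
        · rw [F.lam_mul _ ha, F.lam_mul _ hc, h1]
        · rw [F.lam_mul _ hb, F.lam_mul _ hd, h2]
      · exact Or.inr (h.mul hc hd _ _)
    rintro a b c d a' b' c' d' (⟨rfl, rfl⟩ | ⟨ha, hb, hc, hd, h1, h2⟩)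
      (⟨rfl, rfl⟩ | ⟨ha', hb', hc', hd', h1', h2'⟩)
    · exact Or.inl ⟨rfl, rfl⟩
    · refine Or.inr ⟨F.mul_mem_left _ ha', F.mul_mem_left _ hb', F.mul_mem_left _ hc',
        F.mul_mem_left _ hd', Or.inr ?_, hL ha' hb' hc' hd' h2'⟩
      rcases h1' with h | h
      exacts [h.2.2 _, h.mul_left hc' hd' _]
    · refine Or.inr ⟨F.mul_mem_right _ ha, F.mul_mem_right _ hb, F.mul_mem_right _ hc,
        F.mul_mem_right _ hd, hR ha hb hc hd h1, Or.inr ?_⟩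
      rcases h2 with h | h
      exacts [h.2.2 _, h.mul_right hc hd _]
    · exact Or.inr ⟨F.mul_mem_right _ ha, F.mul_mem_right _ hb, F.mul_mem_right _ hc,
        F.mul_mem_right _ hd, hR ha hb hc hd h1, hL ha' hb' hc' hd' h2'⟩
  · rintro a b c d (⟨rfl, rfl⟩ | ⟨ha, hb, hc, hd, h1, h2⟩) hab
    · exact Or.inl rfl
    · refine Or.inr ⟨hc, hd, ?_, ?_⟩
      · rcases h1 with ⟨h, h', -⟩ | h
        · exact (RRel.of_ρ_eq hc ha h.symm j).trans
            ((RRel.of_transCon hab).trans (RRel.of_ρ_eq hb hd h' j))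
        · exact h
      · rcases h2 with ⟨h, h', -⟩ | h
        · exact (LRel.of_lam_eq hc ha h.symm j).trans
            ((LRel.of_transCon hab).trans (LRel.of_lam_eq hb hd h' j))
        · exact h

/-- Here the rows start within one R-class. A left factor that varies with the column breaks this,
but costs one translation and leaves each column related at level j; transitivity along c, a, b, d
then finishes. -/
theorem comm_transCon_top_le (j : ℕ) : comm (F.transCon (j + 1)) ⊤ ≤ F.transCon j := by
  refine comm_le_of_invariant
    (fun a b c d => (a = c ∧ b = d) ∨ (a ∈ K ∧ b ∈ K ∧ c ∈ K ∧ d ∈ K ∧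
      ((F.ρ a = F.ρ b ∧ F.ρ c = F.ρ d ∧ F.RRel (j + 1) a c ∧ F.RRel (j + 1) b d) ∨
        (F.RRel j a c ∧ F.RRel j b d)) ∧
      ((F.lam a = F.lam b ∧ F.lam c = F.lam d ∧ F.LRel (j + 1) a c ∧ F.LRel (j + 1) b d) ∨
        (F.LRel j a c ∧ F.LRel j b d))))
    ?_ ?_ ?_ ?_
  · rintro c d (rfl | ⟨hc, hd, h1, h2⟩)
    · exact Or.inl ⟨rfl, rfl⟩
    · exact Or.inr ⟨hc, hc, hd, hd, Or.inl ⟨rfl, rfl, h1, h1⟩, Or.inl ⟨rfl, rfl, h2, h2⟩⟩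
  · intro a b _
    exact Or.inl ⟨rfl, rfl⟩
  · have hR : ∀ {a b c d x y z w : S}, a ∈ K → b ∈ K → c ∈ K → d ∈ K →
        ((F.ρ a = F.ρ b ∧ F.ρ c = F.ρ d ∧ F.RRel (j + 1) a c ∧ F.RRel (j + 1) b d) ∨
          (F.RRel j a c ∧ F.RRel j b d)) →
        ((F.ρ (a * x) = F.ρ (b * y) ∧ F.ρ (c * z) = F.ρ (d * w) ∧
          F.RRel (j + 1) (a * x) (c * z) ∧ F.RRel (j + 1) (b * y) (d * w)) ∨
          (F.RRel j (a * x) (c * z) ∧ F.RRel j (b * y) (d * w))) := by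
      rintro a b c d x y z w ha hb hc hd (⟨h1, h2, h3, h4⟩ | ⟨h, h'⟩)
      · refine Or.inl ⟨?_, ?_, h3.mul ha hc _ _, h4.mul hb hd _ _⟩
        · rw [F.ρ_mul ha, F.ρ_mul hb, h1]
        · rw [F.ρ_mul hc, F.ρ_mul hd, h2]
      · exact Or.inr ⟨h.mul ha hc _ _, h'.mul hb hd _ _⟩
    have hL : ∀ {a b c d x y z w : S}, a ∈ K → b ∈ K → c ∈ K → d ∈ K →
        ((F.lam a = F.lam b ∧ F.lam c = F.lam d ∧ F.LRel (j + 1) a c ∧ F.LRel (j + 1) b d) ∨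
          (F.LRel j a c ∧ F.LRel j b d)) →
        ((F.lam (x * a) = F.lam (y * b) ∧ F.lam (z * c) = F.lam (w * d) ∧
          F.LRel (j + 1) (x * a) (z * c) ∧ F.LRel (j + 1) (y * b) (w * d)) ∨
          (F.LRel j (x * a) (z * c) ∧ F.LRel j (y * b) (w * d))) := by
      rintro a b c d x y z w ha hb hc hd (⟨h1, h2, h3, h4⟩ | ⟨h, h'⟩)
      · refine Or.inl ⟨?_, ?_, h3.mul ha hc _ _, h4.mul hb hd _ _⟩
        · rw [F.lam_mul _ ha, F.lam_mul _ hb, h1]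
        · rw [F.lam_mul _ hc, F.lam_mul _ hd, h2]
      · exact Or.inr ⟨h.mul ha hc _ _, h'.mul hb hd _ _⟩
    rintro a b c d a' b' c' d' (⟨rfl, rfl⟩ | ⟨ha, hb, hc, hd, h1, h2⟩)
      (⟨rfl, rfl⟩ | ⟨ha', hb', hc', hd', h1', h2'⟩)
    · exact Or.inl ⟨rfl, rfl⟩
    · refine Or.inr ⟨F.mul_mem_left _ ha', F.mul_mem_left _ hb', F.mul_mem_left _ hc',
        F.mul_mem_left _ hd', Or.inr ?_, hL ha' hb' hc' hd' h2'⟩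
      rcases h1' with h | h
      exacts [⟨h.2.2.1 _, h.2.2.2 _⟩, ⟨h.1.mul_left ha' hc' _, h.2.mul_left hb' hd' _⟩]
    · refine Or.inr ⟨F.mul_mem_right _ ha, F.mul_mem_right _ hb, F.mul_mem_right _ hc,
        F.mul_mem_right _ hd, hR ha hb hc hd h1, Or.inr ?_⟩
      rcases h2 with h | h
      exacts [⟨h.2.2.1 _, h.2.2.2 _⟩, ⟨h.1.mul_right ha hc _, h.2.mul_right hb hd _⟩]
    · exact Or.inr ⟨F.mul_mem_right _ ha, F.mul_mem_right _ hb, F.mul_mem_right _ hc,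
        F.mul_mem_right _ hd, hR ha hb hc hd h1, hL ha' hb' hc' hd' h2'⟩
  · rintro a b c d (⟨rfl, rfl⟩ | ⟨ha, hb, hc, hd, h1, h2⟩) hab
    · exact hab
    · refine Or.inr ⟨hc, hd, ?_, ?_⟩
      · rcases h1 with ⟨-, h, -⟩ | ⟨h, h'⟩
        · exact RRel.of_ρ_eq hc hd h j
        · exact h.symm.trans ((RRel.of_transCon hab).trans h')
      · rcases h2 with ⟨-, h, -⟩ | ⟨h, h'⟩
        · exact LRel.of_lam_eq hc hd h j
        · exact h.symm.trans ((LRel.of_transCon hab).trans h')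

/-- The R-classes in an array over K are constant either along rows or along columns, since they
come from its leftmost nonconstant generator, translated by a constant. The same holds for L-classes
and the rightmost one. -/
theorem comm_reesCon_reesCon_le :
    comm (reesCon (K : Set S) fun s _ hx => ⟨F.mul_mem_left s hx, F.mul_mem_right s hx⟩)
      (reesCon (K : Set S) fun s _ hx => ⟨F.mul_mem_left s hx, F.mul_mem_right s hx⟩) ≤
      F.transCon 0 := by
  refine comm_le_of_invariant
    (fun a b c d => (a = b ∧ c = d ∧ a = c) ∨ (a ∈ K ∧ b ∈ K ∧ c ∈ K ∧ d ∈ K ∧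
      ((F.ρ a = F.ρ b ∧ F.ρ c = F.ρ d) ∨ (F.ρ a = F.ρ c ∧ F.ρ b = F.ρ d)) ∧
      ((F.lam a = F.lam b ∧ F.lam c = F.lam d) ∨ (F.lam a = F.lam c ∧ F.lam b = F.lam d))))
    ?_ ?_ ?_ ?_
  · rintro a b (rfl | ⟨ha, hb⟩)
    · exact Or.inl ⟨rfl, rfl, rfl⟩
    · exact Or.inr ⟨ha, ha, hb, hb, Or.inl ⟨rfl, rfl⟩, Or.inl ⟨rfl, rfl⟩⟩
  · rintro a b (rfl | ⟨ha, hb⟩)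
    · exact Or.inl ⟨rfl, rfl, rfl⟩
    · exact Or.inr ⟨ha, hb, ha, hb, Or.inr ⟨rfl, rfl⟩, Or.inr ⟨rfl, rfl⟩⟩
  · rintro a b c d a' b' c' d' (⟨rfl, rfl, rfl⟩ | ⟨ha, hb, hc, hd, h1, h2⟩)
      (⟨rfl, rfl, rfl⟩ | ⟨ha', hb', hc', hd', h1', h2'⟩)
    · exact Or.inl ⟨rfl, rfl, rfl⟩
    · refine Or.inr ⟨F.mul_mem_left _ ha', F.mul_mem_left _ hb', F.mul_mem_left _ hc',
        F.mul_mem_left _ hd', ?_, ?_⟩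
      · rw [← F.ρ_mul_ρ a ha', ← F.ρ_mul_ρ a hb', ← F.ρ_mul_ρ a hc', ← F.ρ_mul_ρ a hd']
        rcases h1' with ⟨h, h'⟩ | ⟨h, h'⟩ <;> simp [h, h']
      · rwa [F.lam_mul _ ha', F.lam_mul _ hb', F.lam_mul _ hc', F.lam_mul _ hd']
    · refine Or.inr ⟨F.mul_mem_right _ ha, F.mul_mem_right _ hb, F.mul_mem_right _ hc,
        F.mul_mem_right _ hd, ?_, ?_⟩
      · rwa [F.ρ_mul ha, F.ρ_mul hb, F.ρ_mul hc, F.ρ_mul hd]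
      · rw [← F.lam_lam_mul ha, ← F.lam_lam_mul hb, ← F.lam_lam_mul hc, ← F.lam_lam_mul hd]
        rcases h2 with ⟨h, h'⟩ | ⟨h, h'⟩ <;> simp [h, h']
    · refine Or.inr ⟨F.mul_mem_right _ ha, F.mul_mem_right _ hb, F.mul_mem_right _ hc,
        F.mul_mem_right _ hd, ?_, ?_⟩
      · rwa [F.ρ_mul ha, F.ρ_mul hb, F.ρ_mul hc, F.ρ_mul hd]
      · rwa [F.lam_mul _ ha', F.lam_mul _ hb', F.lam_mul _ hc', F.lam_mul _ hd']
  · rintro a b c d (⟨rfl, rfl, rfl⟩ | ⟨ha, hb, hc, hd, h1, h2⟩) hab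
    · exact Or.inl rfl
    · refine Or.inr ⟨hc, hd, ?_, ?_⟩
      · have hab' : F.ρ a = F.ρ b := RRel.of_transCon hab
        change F.ρ c = F.ρ d
        rcases h1 with ⟨-, h⟩ | ⟨h, h'⟩
        exacts [h, by rw [← h, hab', h']]
      · have hab' : F.lam a = F.lam b := LRel.of_transCon hab
        change F.lam c = F.lam d
        rcases h2 with ⟨-, h⟩ | ⟨h, h'⟩
        exacts [h, by rw [← h, hab', h']]

/-! ### The group coordinate modulo a normal subgroup. -/

section Shift

variable (M : Subgroup G) [M.Normal]

/-- `b` arises from `a` by multiplication of its group coordinate modulo `M` by `z`. -/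
def Shift (z : G ⧸ M) (a b : S) : Prop :=
  (a = b ∧ z = 1) ∨ (a ∈ K ∧ b ∈ K ∧ F.ρ a = F.ρ b ∧ F.lam a = F.lam b ∧
    (F.γ b : G ⧸ M) = F.γ a * z)

variable {F M}

theorem Shift.refl (a : S) : F.Shift M 1 a a := Or.inl ⟨rfl, rfl⟩

theorem Shift.symm {z : G ⧸ M} {a b : S} (h : F.Shift M z a b) : F.Shift M z⁻¹ b a := by
  rcases h with ⟨rfl, rfl⟩ | ⟨ha, hb, h1, h2, h3⟩
  · exact Or.inl ⟨rfl, inv_one⟩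
  · exact Or.inr ⟨hb, ha, h1.symm, h2.symm, by rw [h3, mul_inv_cancel_right]⟩

theorem Shift.trans {z w : G ⧸ M} {a b c : S} (h : F.Shift M z a b) (h' : F.Shift M w b c) :
    F.Shift M (z * w) a c := by
  rcases h with ⟨rfl, rfl⟩ | ⟨ha, hb, h1, h2, h3⟩
  · rwa [one_mul]
  · rcases h' with ⟨rfl, rfl⟩ | ⟨hb', hc, h1', h2', h3'⟩
    · rw [mul_one]
      exact Or.inr ⟨ha, hb, h1, h2, h3⟩
    · exact Or.inr ⟨ha, hc, h1.trans h1', h2.trans h2', by rw [h3', h3, mul_assoc]⟩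

theorem Shift.mul_left {z : G ⧸ M} {a b : S} (h : F.Shift M z a b) (s : S) :
    F.Shift M z (s * a) (s * b) := by
  rcases h with ⟨rfl, rfl⟩ | ⟨ha, hb, h1, h2, h3⟩
  · exact Shift.refl _
  · refine Or.inr ⟨F.mul_mem_left _ ha, F.mul_mem_left _ hb, ?_, ?_, ?_⟩
    · rw [← F.ρ_mul_ρ s ha, h1, F.ρ_mul_ρ s hb]
    · rw [F.lam_mul s ha, F.lam_mul s hb, h2]
    · rw [F.γ_mul_left s ha, F.γ_mul_left s hb, h1, QuotientGroup.mk_mul, QuotientGroup.mk_mul,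
        h3, mul_assoc]

/-- The shift z sits to the right of the group coordinate, so a factor on the right conjugates it
while one on the left does not. The conjugator depends only on s and on the L-class shared by a and
b. -/
theorem Shift.mul_right {z : G ⧸ M} {a b : S} (h : F.Shift M z a b) (s : S) :
    F.Shift M ((F.γ (F.lam a * s) : G ⧸ M)⁻¹ * z * F.γ (F.lam a * s)) (a * s) (b * s) := by
  rcases h with ⟨rfl, rfl⟩ | ⟨ha, hb, h1, h2, h3⟩
  · rw [mul_one, inv_mul_cancel]
    exact Shift.refl _
  · refine Or.inr ⟨F.mul_mem_right _ ha, F.mul_mem_right _ hb, ?_, ?_, ?_⟩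
    · rw [F.ρ_mul ha s, F.ρ_mul hb s, h1]
    · rw [← F.lam_lam_mul ha, h2, F.lam_lam_mul hb]
    · rw [F.γ_mul_right ha, F.γ_mul_right hb, h2, QuotientGroup.mk_mul, QuotientGroup.mk_mul, h3]
      group

theorem Shift.mul {z w : G ⧸ M} {a b a' b' : S} (h : F.Shift M z a b) (h' : F.Shift M w a' b') :
    F.Shift M ((F.γ (F.lam a * a') : G ⧸ M)⁻¹ * z * F.γ (F.lam a * a') * w)
      (a * a') (b * b') :=
  (h.mul_right a').trans (h'.mul_left b)

theorem Shift.mul_of_mem_center {z w : G ⧸ M} {a b a' b' : S} (hz : z ∈ Subgroup.center (G ⧸ M))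
    (h : F.Shift M z a b) (h' : F.Shift M w a' b') : F.Shift M (z * w) (a * a') (b * b') := by
  have := h.mul h'
  rwa [mul_assoc _ z, ← Subgroup.mem_center_iff.1 hz, inv_mul_cancel_left] at this

theorem Shift.eq_one {z : G ⧸ M} {a b : S} (h : F.Shift M z a b) (h' : F.Shift M 1 a b) :
    z = 1 := by
  rcases h with ⟨-, h⟩ | ⟨-, -, -, -, h⟩
  · exact h
  · rcases h' with ⟨rfl, -⟩ | ⟨-, -, -, -, h'⟩
    · exact left_eq_mul.1 h
    · rw [mul_one] at h'
      rw [h'] at h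
      exact left_eq_mul.1 h

variable (F M)

/-- The congruence on `S` that relates the `H`-related elements of `K` whose group coordinates
agree modulo the normal subgroup `M`. -/
def subgroupCon : Con S :=
  conOfTranslations (F.Shift M 1)
    { refl := Shift.refl
      symm := fun h => by simpa using h.symm
      trans := fun h h' => by simpa using h.trans h' }
    (fun s _ _ h => h.mul_left s)
    (fun s _ _ h => by simpa using h.mul_right s)

variable {F M}

theorem Shift.of_subgroupCon {N : Subgroup G} [N.Normal] {a b : S} (h : F.subgroupCon N a b) :
    ∃ z ∈ N.map (QuotientGroup.mk' M), F.Shift M z a b := by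
  rcases h with ⟨rfl, -⟩ | ⟨ha, hb, h1, h2, h3⟩
  · exact ⟨1, one_mem _, Shift.refl a⟩
  · rw [mul_one, eq_comm, QuotientGroup.eq] at h3
    refine ⟨_, Subgroup.mem_map_of_mem _ h3, Or.inr ⟨ha, hb, h1, h2, ?_⟩⟩
    simp

theorem map_mk_le_center {N : Subgroup G} (h : ⁅N, ⊤⁆ ≤ M) :
    N.map (QuotientGroup.mk' M) ≤ Subgroup.center (G ⧸ M) := by
  rw [← Subgroup.commutator_top_right_eq_bot_iff_le_center,
    ← Subgroup.map_top_of_surjective _ (QuotientGroup.mk'_surjective M),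
    ← Subgroup.map_commutator, Subgroup.map_eq_bot_iff, QuotientGroup.ker_mk']
  exact h

variable (F)

/-- Modulo M the elements of N are central, so conjugation disappears: both rows of an array keep
one common central shift, which is trivial once the first row is. -/
theorem comm_top_subgroupCon_le {N : Subgroup G} [N.Normal] (h : ⁅N, ⊤⁆ ≤ M) :
    comm ⊤ (F.subgroupCon N) ≤ F.subgroupCon M := by
  refine comm_le_of_invariant (fun a b c d => ∃ z ∈ Subgroup.center (G ⧸ M),
    F.Shift M z a b ∧ F.Shift M z c d) ?_ ?_ ?_ ?_
  · exact fun a b _ => ⟨1, one_mem _, Shift.refl a, Shift.refl b⟩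
  · intro c d hcd
    obtain ⟨z, hz, hcd⟩ := Shift.of_subgroupCon (M := M) hcd
    exact ⟨z, map_mk_le_center h hz, hcd, hcd⟩
  · rintro a b c d a' b' c' d' ⟨z, hz, h1, h2⟩ ⟨w, hw, h1', h2'⟩
    exact ⟨z * w, mul_mem hz hw, h1.mul_of_mem_center hz h1', h2.mul_of_mem_center hz h2'⟩
  · rintro a b c d ⟨z, hz, h1, h2⟩ hab
    obtain rfl := h1.eq_one hab
    exact h2

theorem comm_subgroupCon_top_le {N : Subgroup G} [N.Normal] (h : ⁅N, ⊤⁆ ≤ M) :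
    comm (F.subgroupCon N) ⊤ ≤ F.subgroupCon M := by
  refine comm_le_of_invariant (fun a b c d => ∃ z ∈ Subgroup.center (G ⧸ M),
    F.Shift M z a c ∧ F.Shift M z b d) ?_ ?_ ?_ ?_
  · intro c d hcd
    obtain ⟨z, hz, hcd⟩ := Shift.of_subgroupCon (M := M) hcd
    exact ⟨z, map_mk_le_center h hz, hcd, hcd⟩
  · exact fun a b _ => ⟨1, one_mem _, Shift.refl a, Shift.refl b⟩
  · rintro a b c d a' b' c' d' ⟨z, hz, h1, h2⟩ ⟨w, hw, h1', h2'⟩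
    exact ⟨z * w, mul_mem hz hw, h1.mul_of_mem_center hz h1', h2.mul_of_mem_center hz h2'⟩
  · rintro a b c d ⟨z, hz, h1, h2⟩ hab
    have := (h1.symm.trans (Shift.trans hab h2))
    rwa [one_mul, inv_mul_cancel] at this

/-- An array is a parallelogram: from the corner a, the others are reached by y, x and xy with x in
A and y in B modulo M. In a product all three shifts are conjugated by the same q, and the images of
A and B commute, so the shape survives. -/
theorem comm_subgroupCon_subgroupCon_le {A B : Subgroup G} [A.Normal] [B.Normal]
    (h : ⁅A, B⁆ ≤ M) : comm (F.subgroupCon A) (F.subgroupCon B) ≤ F.subgroupCon M := by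
  have hcomm : ∀ x ∈ A.map (QuotientGroup.mk' M), ∀ y ∈ B.map (QuotientGroup.mk' M),
      x * y = y * x := by
    rintro _ ⟨x, hx, rfl⟩ _ ⟨y, hy, rfl⟩
    rw [← commutatorElement_eq_one_iff_mul_comm, ← map_commutatorElement]
    exact (QuotientGroup.eq_one_iff _).2 (h (Subgroup.commutator_mem_commutator hx hy))
  have hA : (A.map (QuotientGroup.mk' M)).Normal :=
    Subgroup.Normal.map inferInstance _ (QuotientGroup.mk'_surjective M)
  have hB : (B.map (QuotientGroup.mk' M)).Normal :=
    Subgroup.Normal.map inferInstance _ (QuotientGroup.mk'_surjective M)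
  refine comm_le_of_invariant (fun a b c d => ∃ x ∈ A.map (QuotientGroup.mk' M),
    ∃ y ∈ B.map (QuotientGroup.mk' M),
    F.Shift M y a b ∧ F.Shift M x a c ∧ F.Shift M (x * y) a d) ?_ ?_ ?_ ?_
  · intro c d hcd
    obtain ⟨x, hx, hcd⟩ := Shift.of_subgroupCon (M := M) hcd
    exact ⟨x, hx, 1, one_mem _, Shift.refl c, hcd, by rwa [mul_one]⟩
  · intro c d hcd
    obtain ⟨y, hy, hcd⟩ := Shift.of_subgroupCon (M := M) hcd
    exact ⟨1, one_mem _, y, hy, hcd, Shift.refl c, by rwa [one_mul]⟩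
  · rintro a b c d a' b' c' d' ⟨x, hx, y, hy, h1, h2, h3⟩ ⟨x', hx', y', hy', h1', h2', h3'⟩
    have hb := h1.mul h1'
    have hc := h2.mul h2'
    have hd := h3.mul h3'
    generalize (F.γ (F.lam a * a') : G ⧸ M) = q at hb hc hd
    have hxq : q⁻¹ * x * q ∈ A.map (QuotientGroup.mk' M) := by
      simpa using hA.conj_mem x hx q⁻¹
    have hyq : q⁻¹ * y * q ∈ B.map (QuotientGroup.mk' M) := by
      simpa using hB.conj_mem y hy q⁻¹
    refine ⟨q⁻¹ * x * q * x', mul_mem hxq hx', q⁻¹ * y * q * y', mul_mem hyq hy', hb, hc, ?_⟩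
    have h4 := hcomm _ hx' _ hyq
    have h5 : q⁻¹ * x * q * x' * (q⁻¹ * y * q * y') = q⁻¹ * (x * y) * q * (x' * y') := by
      calc q⁻¹ * x * q * x' * (q⁻¹ * y * q * y')
          = q⁻¹ * x * q * (x' * (q⁻¹ * y * q)) * y' := by simp only [mul_assoc]
        _ = q⁻¹ * (x * y) * q * (x' * y') := by rw [h4]; group
    rwa [h5]
  · rintro a b c d ⟨x, hx, y, hy, h1, h2, h3⟩ hab
    obtain rfl := h1.eq_one hab
    have := h2.symm.trans h3
    rwa [mul_one, inv_mul_cancel] at this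

theorem transCon_zero_le_subgroupCon_top : F.transCon 0 ≤ F.subgroupCon ⊤ := by
  rintro x y (rfl | ⟨hx, hy, h1, h2⟩)
  · exact Shift.refl x
  · exact Or.inr ⟨hx, hy, h1, h2, by rw [mul_one]; exact QuotientGroup.eq.2 trivial⟩

theorem subgroupCon_eq_bot {N : Subgroup G} [N.Normal] (h : N = ⊥) : F.subgroupCon N = ⊥ := by
  rw [eq_bot_iff]
  rintro x y (⟨rfl, -⟩ | ⟨hx, hy, h1, h2, h3⟩)
  · rfl
  · rw [mul_one, eq_comm, QuotientGroup.eq, h, Subgroup.mem_bot, inv_mul_eq_one] at h3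
    exact F.ext hx hy h1 h2 h3

end Shift

end Frame

end Congruences

/-! ### Commutators of terms of the lower central series. -/

section LowerCentralSeries

variable {G : Type u} [Group G]

open Subgroup in
/-- The three subgroups lemma modulo a normal subgroup. -/
theorem commutator_commutator_le_of_rotate {A B C N : Subgroup G} [N.Normal]
    (h1 : ⁅⁅B, C⁆, A⁆ ≤ N) (h2 : ⁅⁅C, A⁆, B⁆ ≤ N) : ⁅⁅A, B⁆, C⁆ ≤ N := by
  have key : ∀ X : Subgroup G, X ≤ N ↔ X.map (QuotientGroup.mk' N) = ⊥ := fun X => by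
    rw [Subgroup.map_eq_bot_iff, QuotientGroup.ker_mk']
  rw [key, map_commutator, map_commutator] at h1 h2 ⊢
  exact commutator_commutator_eq_bot_of_rotate h1 h2

theorem commutator_lowerCentralSeries_le (i j : ℕ) :
    ⁅(⊤ : Subgroup G).lowerCentralSeries i, (⊤ : Subgroup G).lowerCentralSeries j⁆ ≤
      (⊤ : Subgroup G).lowerCentralSeries (i + j + 1) := by
  induction j generalizing i with
  | zero => exact le_of_eq rfl
  | succ j ih =>
    rw [Subgroup.lowerCentralSeries_succ _ j, Subgroup.commutator_comm]
    apply commutator_commutator_le_of_rotate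
    · rw [Subgroup.commutator_comm ⊤, ← Subgroup.lowerCentralSeries_succ]
      refine (ih (i + 1)).trans (le_of_eq ?_)
      congr 1; ring
    · exact Subgroup.commutator_mono (ih i) le_rfl

end LowerCentralSeries

/-! ### Host–Kra cubes of a filtered group. -/

section HostKra

open scoped commutatorElement

variable {G : Type u} [Group G]

/-- The Host–Kra cubes of dimension `N` for the filtration `i ↦ Φ (k + i)`. -/
def HostKra (Φ : ℕ → Subgroup G) : (N : ℕ) → ℕ → ((Fin N → Bool) → G) → Prop
  | 0, k, F => ∀ v, F v ∈ Φ k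
  | N + 1, k, F => HostKra Φ N k (fun v => F (Fin.cons false v)) ∧
      HostKra Φ N (k + 1) (fun v => (F (Fin.cons false v))⁻¹ * F (Fin.cons true v))

namespace HostKra

variable {Φ : ℕ → Subgroup G} {N k : ℕ} {E F H : (Fin N → Bool) → G}

theorem one : HostKra Φ N k (1 : (Fin N → Bool) → G) := by
  induction N generalizing k with
  | zero => exact fun _ => one_mem _
  | succ N ih =>
    refine ⟨ih, ?_⟩
    simp only [Pi.one_apply, inv_one, one_mul]
    exact ih

theorem anti (hΦ : Antitone Φ) {j : ℕ} (hjk : j ≤ k) (h : HostKra Φ N k F) :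
    HostKra Φ N j F := by
  induction N generalizing k j with
  | zero => exact fun v => hΦ hjk (h v)
  | succ N ih => exact ⟨ih hjk h.1, ih (Nat.succ_le_succ hjk) h.2⟩

/-- The closure properties of the Host–Kra cubes of dimension `N`. -/
structure IsGroupLike (Φ : ℕ → Subgroup G) (N : ℕ) : Prop where
  mul : ∀ {k F H}, HostKra Φ N k F → HostKra Φ N k H → HostKra Φ N k (F * H)
  inv : ∀ {k F}, HostKra Φ N k F → HostKra Φ N k F⁻¹
  commutator : ∀ {i j F H}, HostKra Φ N i F → HostKra Φ N j H → HostKra Φ N (i + j) ⁅F, H⁆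

theorem IsGroupLike.conj (hN : IsGroupLike Φ N) (hΦ : Antitone Φ) {j : ℕ}
    (hF : HostKra Φ N k F) (hH : HostKra Φ N j H) : HostKra Φ N k (H * F * H⁻¹) := by
  have h := hN.mul (anti hΦ (by omega : k ≤ j + k) (hN.commutator hH hF)) hF
  rwa [commutatorElement_def, inv_mul_cancel_right] at h

/-- The closure properties need a joint induction: the difference of the two faces of a product
involves a conjugate in lower dimension, and conjugation is controlled by commutators. -/
theorem isGroupLike (hΦ : Antitone Φ) (hc : ∀ i j, ⁅Φ i, Φ j⁆ ≤ Φ (i + j)) (N : ℕ) :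
    IsGroupLike Φ N := by
  induction N with
  | zero =>
    exact ⟨fun hF hH v => mul_mem (hF v) (hH v), fun hF v => inv_mem (hF v),
      fun hF hH v => hc _ _ (Subgroup.commutator_mem_commutator (hF v) (hH v))⟩
  | succ N ih =>
    have hmul : ∀ {k F H}, HostKra Φ (N + 1) k F → HostKra Φ (N + 1) k H →
        HostKra Φ (N + 1) k (F * H) := by
      intro k F H hF hH
      refine ⟨ih.mul hF.1 hH.1, ?_⟩
      convert ih.mul (ih.conj hΦ hF.2 (ih.inv hH.1)) hH.2 using 1
      funext v
      simp only [Pi.mul_apply, Pi.inv_apply]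
      group
    have hinv : ∀ {k F}, HostKra Φ (N + 1) k F → HostKra Φ (N + 1) k F⁻¹ := by
      intro k F hF
      refine ⟨ih.inv hF.1, ?_⟩
      convert ih.conj hΦ (ih.inv hF.2) hF.1 using 1
      funext v
      simp only [Pi.mul_apply, Pi.inv_apply]
      group
    refine ⟨hmul, hinv, ?_⟩
    intro i j F H hF hH
    refine ⟨ih.commutator hF.1 hH.1, ?_⟩
    obtain ⟨hx, ha⟩ := hF
    obtain ⟨hy, hb⟩ := hH
    set x : (Fin N → Bool) → G := fun v => F (Fin.cons false v)
    set y : (Fin N → Bool) → G := fun v => H (Fin.cons false v)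
    set a : (Fin N → Bool) → G := fun v => (F (Fin.cons false v))⁻¹ * F (Fin.cons true v)
    set b : (Fin N → Bool) → G := fun v => (H (Fin.cons false v))⁻¹ * H (Fin.cons true v)
    have hyb : HostKra Φ N j (y * b) := ih.mul hy (anti hΦ (Nat.le_succ j) hb)
    have h1 : HostKra Φ N (i + j + 1) ⁅a, y * b⁆ := by
      have := ih.commutator ha hyb
      rwa [add_right_comm] at this
    have h2 : HostKra Φ N (i + j + 1) ⁅x, b⁆ := by
      have := ih.commutator hx hb
      rwa [← add_assoc] at this
    -- The identity behind this is [xa, yb] = x[a, yb]x⁻¹ · [x, y] · y[x, b]y⁻¹, divided on the left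
    -- by [x, y].
    have h3 := ih.conj hΦ (ih.conj hΦ h1 hx) (ih.inv (ih.commutator hx hy))
    convert ih.mul h3 (ih.conj hΦ h2 hy) using 1
    funext v
    have hxa : F (Fin.cons true v) = x v * a v := by simp [x, a]
    have hyb' : H (Fin.cons true v) = y v * b v := by simp [y, b]
    change ⁅x v, y v⁆⁻¹ * ⁅F (Fin.cons true v), H (Fin.cons true v)⁆ =
      ⁅x v, y v⁆⁻¹ * (x v * ⁅a v, y v * b v⁆ * (x v)⁻¹) * ⁅x v, y v⁆⁻¹⁻¹ *
        (y v * ⁅x v, b v⁆ * (y v)⁻¹)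
    rw [hxa, hyb']
    simp only [commutatorElement_def]
    group

/-- A cube that is trivial at all vertices but the last one has its last entry in `Φ (k + N)`. -/
theorem apply_top_mem (h : HostKra Φ N k F) (h1 : ∀ v, v ≠ (fun _ => true) → F v = 1) :
    F (fun _ => true) ∈ Φ (k + N) := by
  induction N generalizing k with
  | zero => exact h _
  | succ N ih =>
    have h0 : ∀ v : Fin N → Bool, F (Fin.cons false v) = 1 := fun v =>
      h1 _ fun hv => by simpa using congrFun hv 0
    have := ih (k := k + 1) h.2 fun v hv => by
      rw [h0, inv_one, one_mul]
      refine h1 _ fun hv' => hv ?_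
      funext i
      simpa using congrFun hv' i.succ
    rw [h0, inv_one, one_mul] at this
    have hcons : (Fin.cons true (fun _ => true) : Fin (N + 1) → Bool) = fun _ => true := by
      funext i
      refine Fin.cases rfl (fun _ => rfl) i
    rw [hcons] at this
    convert this using 2
    ring

/-- A function that depends on at most `D` coordinates is a cube if the first `D + 1` terms of the
filtration are the whole group. -/
theorem of_dependsOn {D : ℕ} (hΦ : ∀ i ≤ D, Φ i = ⊤) (A : Finset (Fin N)) (hA : A.card + k ≤ D)
    (hF : ∀ v w : Fin N → Bool, (∀ i ∈ A, v i = w i) → F v = F w) : HostKra Φ N k F := by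
  induction N generalizing k with
  | zero =>
    intro v
    rw [hΦ k (by omega)]
    trivial
  | succ N ih =>
    set B : Finset (Fin N) := Finset.univ.filter fun i => i.succ ∈ A
    have hBA : B.map (Fin.succEmb N) ⊆ A.erase 0 := by
      intro i hi
      obtain ⟨j, hj, rfl⟩ := Finset.mem_map.1 hi
      exact Finset.mem_erase.2 ⟨Fin.succ_ne_zero j, (Finset.mem_filter.1 hj).2⟩
    have hcard := Finset.card_le_card hBA
    rw [Finset.card_map] at hcard
    have hB : ∀ (c : Bool) (v w : Fin N → Bool), (∀ i ∈ B, v i = w i) →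
        F (Fin.cons c v) = F (Fin.cons c w) := by
      intro c v w hvw
      refine hF _ _ fun i => Fin.cases (fun _ => rfl) (fun j hj => ?_) i
      exact hvw j (Finset.mem_filter.2 ⟨Finset.mem_univ _, hj⟩)
    refine ⟨ih B ?_ (hB false), ?_⟩
    · have := Finset.card_le_card (Finset.erase_subset 0 A)
      omega
    · by_cases h0 : (0 : Fin (N + 1)) ∈ A
      · refine ih B ?_ fun v w hvw => by rw [hB false v w hvw, hB true v w hvw]
        have := Finset.card_erase_lt_of_mem h0
        omega
      · convert one (Φ := Φ) (N := N) (k := k + 1) using 1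
        funext v
        rw [Pi.one_apply, inv_mul_eq_one]
        refine hF _ _ fun i => Fin.cases (fun h => absurd h h0) (fun _ _ => rfl) i

end HostKra

/-- The filtration of a group that repeats each term of the lower central series `D` times. -/
def slowSeries (G : Type u) [Group G] (D k : ℕ) : Subgroup G :=
  -- With truncated subtraction the indices 0, …, D all give G, and the term number c starts at
  -- index cD + 1 when c and D are positive.
  (⊤ : Subgroup G).lowerCentralSeries ((k - 1) / D)

theorem slowSeries_antitone (D : ℕ) : Antitone (slowSeries G D) := fun _ _ h =>
  Subgroup.lowerCentralSeries_antitone _ (Nat.div_le_div_right (Nat.sub_le_sub_right h 1))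

theorem slowSeries_eq_top {D i : ℕ} (h : i ≤ D) (hD : D ≠ 0) : slowSeries G D i = ⊤ := by
  rw [slowSeries, Nat.div_eq_of_lt (by omega)]
  rfl

instance slowSeries_normal (D k : ℕ) : (slowSeries G D k).Normal :=
  Subgroup.lowerCentralSeries_normal _ _

/-- For positive indices i + 1 and j + 1, the gain of 1 in the lower central series outweighs the
rounding, as ⌊(i + j + 1)/D⌋ ≤ ⌊i/D⌋ + ⌊j/D⌋ + 1. -/
theorem commutator_slowSeries_le {D : ℕ} (hD : D ≠ 0) (i j : ℕ) :
    ⁅slowSeries G D i, slowSeries G D j⁆ ≤ slowSeries G D (i + j) := by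
  rcases i with - | i
  · rw [zero_add, slowSeries_eq_top (Nat.zero_le D) hD]
    exact Subgroup.commutator_le_right _ _
  rcases j with - | j
  · rw [add_zero, slowSeries_eq_top (Nat.zero_le D) hD]
    exact Subgroup.commutator_le_left _ _
  · refine (commutator_lowerCentralSeries_le _ _).trans ?_
    apply Subgroup.lowerCentralSeries_antitone _
    have h0 : 0 < D := Nat.pos_of_ne_zero hD
    have hi := Nat.div_add_mod i D
    have hj := Nat.div_add_mod j D
    have hi' := Nat.mod_lt i h0
    have hj' := Nat.mod_lt j h0
    simp only [Nat.add_sub_cancel]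
    rw [← Nat.lt_succ_iff, Nat.div_lt_iff_lt_mul h0]
    have : (i / D + j / D + 1 + 1) * D = D * (i / D) + D * (j / D) + D + D := by ring
    rw [Nat.succ_eq_add_one, this]
    omega

end HostKra

/-! ### Consequences of supernilpotence for K and its subgroups. -/

section HigherLowerBounds

variable {S : Type u} [Semigroup S] {n : ℕ}

theorem row_mem_cubes (i : Fin n) (a b : S) :
    (fun r _ => if r i then b else a : (Fin n → Bool) → Bool → S) ∈
      cubes (fun _ : Fin (n + 1) => (⊤ : Con S)) :=
  Subsemigroup.subset_closure (Or.inl ⟨i, a, b, trivial, rfl⟩)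

theorem col_mem_cubes (a b : S) :
    (fun _ c => if c then b else a : (Fin n → Bool) → Bool → S) ∈
      cubes (fun _ : Fin (n + 1) => (⊤ : Con S)) :=
  Subsemigroup.subset_closure (Or.inr ⟨a, b, trivial, rfl⟩)

/-- The partial products of `s₁ (s₁ e₁ if r₁ = 0), s₂ (s₂ e₂ if r₂ = 0), …` with idempotents `eᵢ`
chosen so that `eᵢ sᵢ₊₁ eᵢ₊₁ = eᵢ sᵢ₊₁`. -/
theorem exists_cube_of_mem_power {K : Subsemigroup S} {G : Type u} [Group G] (F : Frame K G)
    (k : ℕ) (hk : k < n) {a : S} (ha : a ∈ power S (k + 1)) :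
    ∃ x ∈ cubes (fun _ : Fin (n + 1) => (⊤ : Con S)), ∃ e ∈ K, e * e = e ∧
      (∀ r, (∀ i : Fin n, i.1 ≤ k → r i = true) → ∀ c, x r c = a) ∧
      (∀ r, (∃ i : Fin n, i.1 ≤ k ∧ r i = false) → ∀ c, x r c * e = x r false) ∧
      ∀ r c, x r c = x r false := by
  induction k generalizing a with
  | zero =>
    refine ⟨_, row_mem_cubes ⟨0, hk⟩ (a * F.ι 1) a, F.ι 1, F.ι_mem 1, F.ι_one_mul 1, ?_, ?_,
      fun _ _ => rfl⟩
    · intro r hr c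
      simp [hr ⟨0, hk⟩ le_rfl]
    · rintro r ⟨i, hi, hri⟩ c
      have : i = ⟨0, hk⟩ := Fin.ext (Nat.le_zero.1 hi)
      subst this
      simp only [hri, Bool.false_eq_true, if_false]
      rw [mul_assoc, F.ι_one_mul]
  | succ k ih =>
    obtain ⟨a, ha, s, rfl⟩ := ha
    obtain ⟨x, hx, e, he, hee, h1, h2, h3⟩ := ih (Nat.lt_of_succ_lt hk) ha
    -- Only (es)e' = es matters: where e can already be inserted, the new factor e' is invisible
    -- after s.
    obtain ⟨e', he', hee', hse, -⟩ := F.exists_idempotent (F.mul_mem_right s he) he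
    refine ⟨_, mul_mem hx (row_mem_cubes ⟨k + 1, hk⟩ (s * e') s), e', he', hee', ?_, ?_, ?_⟩
    · intro r hr c
      simp only [Pi.mul_apply]
      rw [h1 r (fun i hi => hr i (hi.trans (Nat.le_succ k))), hr ⟨k + 1, hk⟩ le_rfl, if_pos rfl]
    · rintro r ⟨i, hi, hri⟩ c
      simp only [Pi.mul_apply]
      rw [h3 r c]
      by_cases hr : r ⟨k + 1, hk⟩ = true
      · have hik : i.1 ≤ k := by
          rcases Nat.lt_or_eq_of_le hi with h | h
          · omega
          · have : i = ⟨k + 1, hk⟩ := Fin.ext h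
            rw [← this, hri] at hr
            exact absurd hr Bool.false_ne_true
        rw [hr, if_pos rfl, ← h2 r ⟨i, hik, hri⟩ false, mul_assoc _ e s, mul_assoc _ _ e', hse]
      · rw [if_neg hr, ← mul_assoc, mul_assoc _ e' e', hee']
    · intro r c
      simp only [Pi.mul_apply]
      rw [h3 r c]

/-- A last factor es or s, according to the column, is invisible in every row but the last, where
the term condition yields aes = as; the left side lies in K. -/
theorem power_subset_of_higherComm_eq_bot {K : Subsemigroup S} {G : Type u} [Group G]
    (F : Frame K G) (h : SupernilpotentOfClass S n) : power S (n + 1) ⊆ K := by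
  have hbot := (isLeast_higherComm (fun _ : Fin (n + 1) => (⊤ : Con S))).1
  rw [show higherComm _ = ⊥ from h] at hbot
  cases n with
  | zero =>
    intro a _
    have : F.ι 1 = a := hbot _ (col_mem_cubes (F.ι 1) a) fun r hr =>
      absurd (Subsingleton.elim r _) hr
    exact this ▸ F.ι_mem 1
  | succ n =>
    rintro _ ⟨a, ha, s, rfl⟩
    obtain ⟨x, hx, e, he, hee, h1, h2, h3⟩ := exists_cube_of_mem_power F n (Nat.lt_succ_self n) ha
    have key : x (fun _ => true) false * (e * s) = x (fun _ => true) true * s := by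
      refine hbot _ (mul_mem hx (col_mem_cubes (e * s) s)) fun r hr => ?_
      obtain ⟨i, hi⟩ : ∃ i, r i = false := by
        by_contra hcon
        push Not at hcon
        exact hr (funext fun i => by simpa using hcon i)
      change x r false * (e * s) = x r true * s
      rw [h3 r true, ← mul_assoc, h2 r ⟨i, Nat.lt_succ_iff.1 i.2, hi⟩]
    rw [h1 _ (fun _ _ => rfl), h1 _ (fun _ _ => rfl)] at key
    change a * s ∈ K
    rw [← key]
    exact F.mul_mem_left _ (F.mul_mem_right _ he)

open scoped commutatorElement in
-- An iterated commutator collapses to 1 as soon as one argument is switched off, and each argument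
-- gets its own coordinate. The inverse array is carried along because `cubes` is only a
-- subsemigroup.
theorem exists_groupCube_of_mem_lowerCentralSeries {G : Type u} [Group G] (f : G →ₙ* S) (k : ℕ)
    (hk : k ≤ n) {g : G} (hg : g ∈ (⊤ : Subgroup G).lowerCentralSeries k) :
    ∃ x : (Fin n → Bool) → Bool → G,
      (fun r c => f (x r c)) ∈ cubes (fun _ : Fin (n + 1) => (⊤ : Con S)) ∧
      (fun r c => f (x r c)⁻¹) ∈ cubes (fun _ : Fin (n + 1) => (⊤ : Con S)) ∧
      (∀ r, (∀ i : Fin n, i.1 < k → r i = true) → x r true = g) ∧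
      (∀ r, (∃ i : Fin n, i.1 < k ∧ r i = false) → x r true = 1) ∧
      ∀ r, x r false = 1 := by
  induction k generalizing g with
  | zero =>
    refine ⟨fun _ c => if c then g else 1, ?_, ?_, fun _ _ => if_pos rfl, ?_, fun _ => by simp⟩
    · convert col_mem_cubes (n := n) (f 1) (f g) using 1
      funext r c
      cases c <;> rfl
    · convert col_mem_cubes (n := n) (f 1⁻¹) (f g⁻¹) using 1
      funext r c
      cases c <;> rfl
    · rintro r ⟨i, hi, -⟩
      exact absurd hi (Nat.not_lt_zero _)
  | succ k ih =>
    rw [Subgroup.lowerCentralSeries_succ, Subgroup.commutator_def] at hg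
    induction hg using Subgroup.closure_induction with
    | mem g hg =>
      obtain ⟨a, ha, b, -, rfl⟩ := hg
      obtain ⟨x, hx, hx', h1, h2, h3⟩ := ih (Nat.le_of_succ_le hk) ha
      set y : (Fin n → Bool) → Bool → G := fun r _ => if r ⟨k, hk⟩ then b else 1 with hy_def
      have hy : (fun r c => f (y r c)) ∈ cubes (fun _ : Fin (n + 1) => (⊤ : Con S)) := by
        convert row_mem_cubes (n := n) ⟨k, hk⟩ (f 1) (f b) using 3
        simp only [hy_def]
        split_ifs <;> rfl
      have hy' : (fun r c => f (y r c)⁻¹) ∈ cubes (fun _ : Fin (n + 1) => (⊤ : Con S)) := by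
        convert row_mem_cubes (n := n) ⟨k, hk⟩ (f 1⁻¹) (f b⁻¹) using 3
        simp only [hy_def]
        split_ifs <;> rfl
      refine ⟨fun r c => ⁅x r c, y r c⁆, ?_, ?_, ?_, ?_, ?_⟩
      · convert mul_mem (mul_mem (mul_mem hx hy) hx') hy' using 1
        funext r c
        simp only [commutatorElement_def, map_mul, Pi.mul_apply]
      · convert mul_mem (mul_mem (mul_mem hy hx) hy') hx' using 1
        funext r c
        simp only [commutatorElement_inv]
        simp only [commutatorElement_def, map_mul, Pi.mul_apply]
      · intro r hr
        have := h1 r fun i hi => hr i (Nat.lt_succ_of_lt hi)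
        simp only [this, hy_def, hr ⟨k, hk⟩ (Nat.lt_succ_self k), if_true]
      · rintro r ⟨i, hi, hri⟩
        rcases Nat.lt_or_eq_of_le (Nat.lt_succ_iff.1 hi) with h | h
        · simp only [h2 r ⟨i, h, hri⟩, commutatorElement_one_left]
        · have : i = ⟨k, hk⟩ := Fin.ext h
          subst this
          simp [hy_def, hri]
      · intro r
        simp only [h3, commutatorElement_one_left]
    | one =>
      refine ⟨fun _ _ => 1, ?_, ?_, fun _ _ => rfl, fun _ _ => rfl, fun _ => rfl⟩
      · convert col_mem_cubes (n := n) (f 1) (f 1) using 3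
        exact (ite_self _).symm
      · convert col_mem_cubes (n := n) (f 1⁻¹) (f 1⁻¹) using 3
        exact (ite_self _).symm
    | mul g h _ _ hg hh =>
      obtain ⟨x, hx, hx', h1, h2, h3⟩ := hg
      obtain ⟨y, hy, hy', h1', h2', h3'⟩ := hh
      refine ⟨fun r c => x r c * y r c, ?_, ?_, fun r hr => by simp only [h1 r hr, h1' r hr],
        fun r hr => by simp only [h2 r hr, h2' r hr, one_mul],
        fun r => by simp only [h3, h3', one_mul]⟩
      · convert mul_mem hx hy using 1
        funext r c
        exact map_mul _ _ _
      · convert mul_mem hy' hx' using 1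
        funext r c
        rw [mul_inv_rev, map_mul]
        rfl
    | inv g _ hg =>
      obtain ⟨x, hx, hx', h1, h2, h3⟩ := hg
      refine ⟨fun r c => (x r c)⁻¹, hx', by simpa using hx, fun r hr => by simp only [h1 r hr],
        fun r hr => by simp only [h2 r hr, inv_one], fun r => by simp only [h3, inv_one]⟩

theorem lowerCentralSeries_eq_bot_of_higherComm_eq_bot {G : Type u} [Group G] {f : G →ₙ* S}
    (hf : Function.Injective f) (h : SupernilpotentOfClass S n) :
    (⊤ : Subgroup G).lowerCentralSeries n = ⊥ := by
  have hbot := (isLeast_higherComm (fun _ : Fin (n + 1) => (⊤ : Con S))).1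
  rw [show higherComm _ = ⊥ from h] at hbot
  refine (Subgroup.eq_bot_iff_forall _).2 fun g hg => ?_
  obtain ⟨x, hx, -, h1, h2, h3⟩ := exists_groupCube_of_mem_lowerCentralSeries f n le_rfl hg
  have key : f (x (fun _ => true) false) = f (x (fun _ => true) true) := by
    refine hbot _ hx fun r hr => ?_
    obtain ⟨i, hi⟩ : ∃ i, r i = false := by
      by_contra hcon
      push Not at hcon
      exact hr (funext fun i => by simpa using hcon i)
    change f (x r false) = f (x r true)
    rw [h3, h2 r ⟨i, i.2, hi⟩]
  rw [h3, h1 _ fun _ _ => rfl] at key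
  exact (hf key).symm

end HigherLowerBounds

/-! ### Words on cubes and the upper bound for supernilpotence. -/

section HigherUpperBounds

variable {S : Type u} [Semigroup S] {n : ℕ}

/-- The value at the vertex `v` of the formal product of the generators `(j, a, b)`, which take
the value `b` if `v j` and `a` otherwise. -/
def evalWord (L : List (Fin n × S × S)) (v : Fin n → Bool) : WithOne S :=
  (L.map fun p => ((if v p.1 then p.2.2 else p.2.1 : S) : WithOne S)).prod

theorem evalWord_append (L L' : List (Fin n × S × S)) (v : Fin n → Bool) :
    evalWord (L ++ L') v = evalWord L v * evalWord L' v := by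
  rw [evalWord, List.map_append, List.prod_append, evalWord, evalWord]

theorem evalWord_congr (L : List (Fin n × S × S)) {v w : Fin n → Bool}
    (h : ∀ p ∈ L, v p.1 = w p.1) : evalWord L v = evalWord L w := by
  rw [evalWord, evalWord]
  congr 1
  exact List.map_congr_left fun p hp => by rw [h p hp]

theorem exists_evalWord_eq_coe (L : List (Fin n × S × S)) (hL : L ≠ []) (v : Fin n → Bool) :
    ∃ z ∈ power S L.length, evalWord L v = (z : WithOne S) := by
  induction L with
  | nil => exact absurd rfl hL
  | cons p L ih =>
    rcases eq_or_ne L [] with rfl | hL'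
    · exact ⟨_, trivial, by simp [evalWord]; rfl⟩
    · obtain ⟨z, hz, hzL⟩ := ih hL'
      obtain ⟨k, hk⟩ := Nat.exists_eq_succ_of_ne_zero (mt List.length_eq_zero_iff.1 hL')
      refine ⟨(if v p.1 then p.2.2 else p.2.1) * z, ?_, ?_⟩
      · rw [List.length_cons, hk]
        rw [hk] at hz
        have := power_mul_mem 0 k (a := if v p.1 then p.2.2 else p.2.1) trivial hz
        rwa [zero_add] at this
      · rw [WithOne.coe_mul, ← hzL]
        simp [evalWord]

theorem exists_word_of_mem_cubes {x : (Fin n → Bool) → Bool → S}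
    (hx : x ∈ cubes (fun _ : Fin (n + 1) => (⊤ : Con S))) :
    ∃ L : List (Fin (n + 1) × S × S), L ≠ [] ∧
      ∀ r c, (x r c : WithOne S) = evalWord L (Fin.cons c r) := by
  induction hx using Subsemigroup.closure_induction with
  | mem x hx =>
    rcases hx with ⟨i, a, b, -, rfl⟩ | ⟨a, b, -, rfl⟩
    · exact ⟨[(i.succ, a, b)], by simp, fun r c => by simp [evalWord]⟩
    · exact ⟨[(0, a, b)], by simp, fun r c => by simp [evalWord]⟩
  | mul x y _ _ hx hy =>
    obtain ⟨L, hL, hx⟩ := hx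
    obtain ⟨L', -, hy⟩ := hy
    refine ⟨L ++ L', by simp [hL], fun r c => ?_⟩
    rw [evalWord_append, ← hx, ← hy]
    rfl

variable {K : Subsemigroup S} {G : Type u} [Group G] (F : Frame K G)

/-- The group coordinate, extended to `S` with an identity adjoined. -/
def Frame.γOne (w : WithOne S) : G := WithOne.recOneCoe 1 F.γ w

theorem Frame.γOne_mul_mul (y : WithOne S) {z : S} (hz : z ∈ K) (w : WithOne S) :
    F.γOne (y * z * w) = F.γOne (y * z) * (F.γOne z)⁻¹ * F.γOne (z * w) := by
  refine WithOne.cases_on y ?_ fun y => ?_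
  · rw [one_mul, mul_inv_cancel, one_mul]
  · refine WithOne.cases_on w ?_ fun w => ?_
    · rw [mul_one, mul_one, inv_mul_cancel_right]
    · exact F.γ_mul_mul y hz w

/-- If products of `m ≥ 1` elements lie in `K`, then the group coordinate of a word is a product
of functions that depend on at most `2 m` coordinates. -/
theorem Frame.hostKra_evalWord {m : ℕ} (hm : 1 ≤ m) (hK : power S m ⊆ K)
    (L : List (Fin n × S × S)) :
    HostKra (slowSeries G (2 * m)) n 0 (fun v => F.γOne (evalWord L v)) := by
  have hD : 2 * m ≠ 0 := by omega
  have hgrp := HostKra.isGroupLike (slowSeries_antitone (G := G) (2 * m))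
    (commutator_slowSeries_le hD) n
  have hshort : ∀ L : List (Fin n × S × S), L.length ≤ 2 * m →
      HostKra (slowSeries G (2 * m)) n 0 (fun v => F.γOne (evalWord L v)) := by
    intro L hL
    refine HostKra.of_dependsOn (fun i hi => slowSeries_eq_top hi hD)
      (L.map Prod.fst).toFinset ?_ fun v w hvw => ?_
    · have := (L.map Prod.fst).toFinset_card_le
      rw [List.length_map] at this
      omega
    · rw [evalWord_congr L fun p hp => hvw _ (by
        rw [List.mem_toFinset]; exact List.mem_map_of_mem hp)]
  induction L with
  | nil => exact hshort [] (Nat.zero_le _)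
  | cons p L ih =>
    by_cases hL : L.length + 1 ≤ 2 * m
    · exact hshort _ hL
    · have hlen : (L.take m).length = m := by rw [List.length_take]; omega
      have hne : L.take m ≠ [] := by
        intro h
        rw [h, List.length_nil] at hlen
        omega
      -- The m letters after p have their value z in K, so `γOne_mul_mul` cuts the word there. The
      -- piece with p has m + 1 letters, at most 2m because m ≥ 1.
      convert hgrp.mul (hgrp.mul (hshort (p :: L.take m) (by rw [List.length_cons]; omega))
        (hgrp.inv (hshort (L.take m) (by omega)))) ih using 1
      funext v
      obtain ⟨z, hz, hzL⟩ := exists_evalWord_eq_coe (L.take m) hne v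
      rw [hlen] at hz
      have h1 : evalWord L v = z * evalWord (L.drop m) v := by
        rw [← hzL, ← evalWord_append, List.take_append_drop]
      have h2 : ∀ T : List (Fin n × S × S), evalWord (p :: T) v = evalWord [p] v * evalWord T v :=
        fun T => evalWord_append [p] T v
      simp only [Pi.mul_apply, Pi.inv_apply]
      rw [h2 L, h2 (L.take m), hzL, h1, ← F.γOne_mul_mul _ (hK hz), mul_assoc]

theorem Frame.ρ_eq_of_coe_eq_mul {x z : S} (hz : z ∈ K) {w : WithOne S}
    (h : (x : WithOne S) = z * w) : F.ρ x = F.ρ z := by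
  revert h
  refine WithOne.cases_on w (fun h => ?_) fun w h => ?_
  · rw [mul_one, WithOne.coe_inj] at h
    rw [h]
  · rw [← WithOne.coe_mul, WithOne.coe_inj] at h
    rw [h, F.ρ_mul hz]

theorem Frame.lam_eq_of_coe_eq_mul {x z : S} (hz : z ∈ K) {w : WithOne S}
    (h : (x : WithOne S) = w * z) : F.lam x = F.lam z := by
  revert h
  refine WithOne.cases_on w (fun h => ?_) fun w h => ?_
  · rw [one_mul, WithOne.coe_inj] at h
    rw [h]
  · rw [← WithOne.coe_mul, WithOne.coe_inj] at h
    rw [h, F.lam_mul _ hz]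

/-- A word with at most `n - 1` letters misses one of the `n` row coordinates. -/
theorem exists_evalWord_update (L : List (Fin (n + 1) × S × S)) (hL : L.length < n) :
    ∃ r : Fin n → Bool, r ≠ (fun _ => true) ∧
      ∀ c, evalWord L (Fin.cons c r) = evalWord L (Fin.cons c fun _ => true) := by
  have hcard := (L.map Prod.fst).toFinset_card_le
  rw [List.length_map] at hcard
  obtain ⟨i, hi⟩ : ∃ i : Fin n, i.succ ∉ (L.map Prod.fst).toFinset := by
    by_contra hcon
    push Not at hcon
    have : Finset.univ.map (Fin.succEmb n) ⊆ (L.map Prod.fst).toFinset := by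
      intro j hj
      obtain ⟨i, -, rfl⟩ := Finset.mem_map.1 hj
      exact hcon i
    have := Finset.card_le_card this
    rw [Finset.card_map, Finset.card_univ, Fintype.card_fin] at this
    omega
  refine ⟨Function.update (fun _ => true) i false, fun h => ?_, fun c => ?_⟩
  · simpa using congrFun h i
  · refine evalWord_congr L fun p hp => ?_
    have hpi : p.1 ≠ i.succ := by
      rintro h
      exact hi (h ▸ List.mem_toFinset.2 (List.mem_map_of_mem hp))
    generalize p.1 = j at hpi
    revert hpi
    refine Fin.cases (fun _ => rfl) (fun j hj => ?_) j
    simp only [Fin.cons_succ]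
    rw [Function.update_of_ne fun h => hj (congrArg Fin.succ h)]

/-- A word of at most m letters misses a row coordinate, so its last row repeats another row. For
longer words all entries lie in K and the three Rees coordinates are compared separately. -/
theorem Frame.supernilpotentOfClass (F : Frame K G) {m k : ℕ} (hm : 1 ≤ m) (hk : 1 ≤ k)
    (hK : power S m ⊆ K) (hG : (⊤ : Subgroup G).lowerCentralSeries k = ⊥) : SupernilpotentOfClass S (2 * m * k) := by
  rw [SupernilpotentOfClass, eq_bot_iff]
  refine sInf_le fun x hx hrow => ?_
  change x (fun _ => true) false = x (fun _ => true) true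
  obtain ⟨L, hL, hxL⟩ := exists_word_of_mem_cubes hx
  have hmk : 2 * m ≤ 2 * m * k := Nat.le_mul_of_pos_right _ hk
  by_cases hlen : L.length ≤ m
  · obtain ⟨r, hr, hrL⟩ := exists_evalWord_update L (by omega : L.length < 2 * m * k)
    have h : ∀ c, x r c = x (fun _ => true) c := fun c => by
      rw [← WithOne.coe_inj, hxL, hxL, hrL]
    rw [← h, ← h]
    exact hrow r hr
  · have hmem : ∀ r c, x r c ∈ K := by
      intro r c
      obtain ⟨z, hz, hzL⟩ := exists_evalWord_eq_coe L hL (Fin.cons c r)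
      rw [← hxL, WithOne.coe_inj] at hzL
      exact hK (power_antitone (by omega : m ≤ L.length) (hzL ▸ hz))
    refine F.ext (hmem _ _) (hmem _ _) ?_ ?_ ?_
    · have htake : (L.take m).length = m := by rw [List.length_take]; omega
      have hne : L.take m ≠ [] := by
        intro h
        rw [h, List.length_nil] at htake
        omega
      obtain ⟨r, hr, hrL⟩ := exists_evalWord_update (n := 2 * m * k) (L.take m) (by omega)
      have h : ∀ c, F.ρ (x r c) = F.ρ (x (fun _ => true) c) := by
        intro c
        obtain ⟨z, hz, hzL⟩ := exists_evalWord_eq_coe (L.take m) hne (Fin.cons c r)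
        rw [htake] at hz
        have h1 : (x r c : WithOne S) = z * evalWord (L.drop m) (Fin.cons c r) := by
          rw [hxL, ← hzL, ← evalWord_append, List.take_append_drop]
        have h2 : (x (fun _ => true) c : WithOne S) =
            z * evalWord (L.drop m) (Fin.cons c fun _ => true) := by
          rw [hxL, ← hzL, hrL, ← evalWord_append, List.take_append_drop]
        rw [F.ρ_eq_of_coe_eq_mul (hK hz) h1, F.ρ_eq_of_coe_eq_mul (hK hz) h2]
      rw [← h, ← h, show x r false = x r true from hrow r hr]
    · have hdrop : (L.drop (L.length - m)).length = m := by rw [List.length_drop]; omega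
      have hne : L.drop (L.length - m) ≠ [] := by
        intro h
        rw [h, List.length_nil] at hdrop
        omega
      obtain ⟨r, hr, hrL⟩ := exists_evalWord_update (n := 2 * m * k) (L.drop (L.length - m))
        (by omega)
      have h : ∀ c, F.lam (x r c) = F.lam (x (fun _ => true) c) := by
        intro c
        obtain ⟨z, hz, hzL⟩ := exists_evalWord_eq_coe (L.drop (L.length - m)) hne (Fin.cons c r)
        rw [hdrop] at hz
        have h1 : (x r c : WithOne S) = evalWord (L.take (L.length - m)) (Fin.cons c r) * z := by
          rw [hxL, ← hzL, ← evalWord_append, List.take_append_drop]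
        have h2 : (x (fun _ => true) c : WithOne S) =
            evalWord (L.take (L.length - m)) (Fin.cons c fun _ => true) * z := by
          rw [hxL, ← hzL, hrL, ← evalWord_append, List.take_append_drop]
        rw [F.lam_eq_of_coe_eq_mul (hK hz) h1, F.lam_eq_of_coe_eq_mul (hK hz) h2]
      rw [← h, ← h, show x r false = x r true from hrow r hr]
    -- Coordinate 0 is the column, so this component is the quotient of the two columns: a cube of
    -- dimension 2mk and degree 1. Its last value lies at index 1 + 2mk of the slowed filtration,
    -- which is the k-th term of the lower central series.
    · have hcube := (F.hostKra_evalWord hm hK L).2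
      have hval : ∀ r c, F.γOne (evalWord L (Fin.cons c r)) = F.γ (x r c) := by
        intro r c
        rw [← hxL]
        rfl
      simp only [hval] at hcube
      have := hcube.apply_top_mem fun r hr => by
        rw [show x r false = x r true from hrow r hr, inv_mul_cancel]
      rw [slowSeries, Nat.zero_add, Nat.add_sub_cancel_left,
        Nat.mul_div_cancel_left _ (by omega), hG, Subgroup.mem_bot, inv_mul_eq_one] at this
      exact this

end HigherUpperBounds

/-! ### Descent of the three kinds of series and the class bounds. -/

section Classification

variable {S : Type u} [Semigroup S] {K : Subsemigroup S}

theorem leftSeries_antitone : Antitone (leftSeries S) :=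
  antitone_nat_of_succ_le fun _ => comm_le_right _ _

theorem rightSeries_antitone : Antitone (rightSeries S) :=
  antitone_nat_of_succ_le fun _ => comm_le_left _ _

namespace Frame

variable {G : Type u} [Group G]

theorem leftSeries_le_transCon (F : Frame K G) {m : ℕ} (hK : power S (m + 1) ⊆ K) (i j : ℕ)
    (hij : i + j = m + 1) : leftSeries S (m + i) ≤ F.transCon j := by
  induction i generalizing j with
  | zero =>
    obtain rfl : j = m + 1 := by omega
    exact (leftSeries_le_reesCon_power m).trans (F.reesCon_le_transCon hK)
  | succ i ih =>
    exact (comm_mono le_rfl (ih (j + 1) (by omega))).trans (F.comm_top_transCon_le j)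

theorem rightSeries_le_transCon (F : Frame K G) {m : ℕ} (hK : power S (m + 1) ⊆ K) (i j : ℕ)
    (hij : i + j = m + 1) : rightSeries S (m + i) ≤ F.transCon j := by
  induction i generalizing j with
  | zero =>
    obtain rfl : j = m + 1 := by omega
    exact (rightSeries_le_reesCon_power m).trans (F.reesCon_le_transCon hK)
  | succ i ih =>
    exact (comm_mono (ih (j + 1) (by omega)) le_rfl).trans (F.comm_transCon_top_le j)

theorem leftSeries_le_subgroupCon (F : Frame K G) {m : ℕ} (hK : power S (m + 1) ⊆ K) (n : ℕ) :
    leftSeries S (m + (m + 1) + n) ≤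
      F.subgroupCon ((⊤ : Subgroup G).lowerCentralSeries n) := by
  induction n with
  | zero =>
    exact (F.leftSeries_le_transCon hK (m + 1) 0 rfl).trans F.transCon_zero_le_subgroupCon_top
  | succ n ih => exact (comm_mono le_rfl ih).trans (F.comm_top_subgroupCon_le le_rfl)

theorem rightSeries_le_subgroupCon (F : Frame K G) {m : ℕ} (hK : power S (m + 1) ⊆ K) (n : ℕ) :
    rightSeries S (m + (m + 1) + n) ≤
      F.subgroupCon ((⊤ : Subgroup G).lowerCentralSeries n) := by
  induction n with
  | zero =>
    exact (F.rightSeries_le_transCon hK (m + 1) 0 rfl).trans F.transCon_zero_le_subgroupCon_top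
  | succ n ih => exact (comm_mono ih le_rfl).trans (F.comm_subgroupCon_top_le le_rfl)

theorem leftNilpotentOfClass (F : Frame K G) {m n : ℕ} (hm : 1 ≤ m) (hK : power S m ⊆ K)
    (hG : (⊤ : Subgroup G).lowerCentralSeries n = ⊥) : LeftNilpotentOfClass S (2 * m + n) := by
  obtain ⟨m, rfl⟩ := Nat.exists_eq_add_of_le' hm
  rw [LeftNilpotentOfClass, eq_bot_iff, ← F.subgroupCon_eq_bot hG]
  -- In terms of the original exponent m, the descent takes only 2m - 1 + n steps, one fewer than
  -- claimed.
  exact (leftSeries_antitone (by omega)).trans (F.leftSeries_le_subgroupCon hK n)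

theorem rightNilpotentOfClass (F : Frame K G) {m n : ℕ} (hm : 1 ≤ m) (hK : power S m ⊆ K)
    (hG : (⊤ : Subgroup G).lowerCentralSeries n = ⊥) : RightNilpotentOfClass S (2 * m + n) := by
  obtain ⟨m, rfl⟩ := Nat.exists_eq_add_of_le' hm
  rw [RightNilpotentOfClass, eq_bot_iff, ← F.subgroupCon_eq_bot hG]
  exact (rightSeries_antitone (by omega)).trans (F.rightSeries_le_subgroupCon hK n)

/-- The extra 1 in the index pays for the single commutator that passes from the Rees congruence of
K to the H-relation on K. -/
theorem derived_le_subgroupCon (F : Frame K G) {i : ℕ} (hK : power S (2 ^ i) ⊆ K) (n : ℕ) :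
    derived (⊤ : Con S) (i + n + 1) ≤ F.subgroupCon (derivedSeries G n) := by
  induction n with
  | zero =>
    have h : derived (⊤ : Con S) i ≤ reesCon (K : Set S) fun s _ hx =>
        ⟨F.mul_mem_left s hx, F.mul_mem_right s hx⟩ := by
      refine (derived_le_reesCon_power i).trans ?_
      rintro x y (rfl | hxy)
      exacts [Or.inl rfl, Or.inr ⟨hK hxy.1, hK hxy.2⟩]
    exact (comm_mono h h).trans (F.comm_reesCon_reesCon_le.trans F.transCon_zero_le_subgroupCon_top)
  | succ n ih => exact (comm_mono ih ih).trans (F.comm_subgroupCon_subgroupCon_le le_rfl)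

theorem solvableOfClass (F : Frame K G) {m n : ℕ} (hK : power S m ⊆ K)
    (hG : derivedSeries G n = ⊥) : SolvableOfClass S (Nat.clog 2 m + n + 1) := by
  rw [SolvableOfClass, eq_bot_iff, ← F.subgroupCon_eq_bot hG]
  exact F.derived_le_subgroupCon
    ((power_antitone (Nat.le_pow_clog one_lt_two m)).trans hK) n

end Frame

theorem SolvableOfClass.bounds {G : Type u} [Group G] (F : Frame K G) {d : ℕ}
    (h : SolvableOfClass S d) : power S (2 ^ d) = K ∧
      SubgroupsSatisfy K (fun G _ => derivedSeries G d = ⊥) := by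
  have hd := absorbs_derived F d
  rw [show derived ⊤ d = ⊥ from h] at hd
  refine ⟨hd.subset.antisymm (F.subset_power _), fun G _ f hf _ =>
    eq_bot_of_forall_rel_bot hf ?_⟩
  rw [← show derived ⊤ d = ⊥ from h]
  exact derived_map_derivedSeries f d

theorem nilpotent_bounds {G : Type u} [Group G] (F : Frame K G) {d : ℕ}
    (h : LeftNilpotentOfClass S d ∨ RightNilpotentOfClass S d ∨ SupernilpotentOfClass S d) :
    power S (d + 1) = K ∧
      SubgroupsSatisfy K (fun G _ => (⊤ : Subgroup G).lowerCentralSeries d = ⊥) := by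
  rcases h with h | h | h
  · have hd := absorbs_leftSeries F d
    rw [show leftSeries S d = ⊥ from h] at hd
    refine ⟨hd.subset.antisymm (F.subset_power _), fun G _ f hf _ =>
      eq_bot_of_forall_rel_bot hf ?_⟩
    rw [← show leftSeries S d = ⊥ from h]
    exact leftSeries_map_lowerCentralSeries f d
  · have hd := absorbs_rightSeries F d
    rw [show rightSeries S d = ⊥ from h] at hd
    refine ⟨hd.subset.antisymm (F.subset_power _), fun G _ f hf _ =>
      eq_bot_of_forall_rel_bot hf ?_⟩
    rw [← show rightSeries S d = ⊥ from h]
    exact rightSeries_map_lowerCentralSeries f d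
  · exact ⟨(power_subset_of_higherComm_eq_bot F h).antisymm (F.subset_power _),
      fun G _ f hf _ => lowerCentralSeries_eq_bot_of_higherComm_eq_bot hf h⟩

theorem nilpotent_structure {G : Type u} [Group G] (F : Frame K G)
    (h : ∃ d, LeftNilpotentOfClass S d ∨ RightNilpotentOfClass S d ∨ SupernilpotentOfClass S d) :
    IsNilpotentExtension K ∧ SubgroupsSatisfy K (fun G _ => Group.IsNilpotent G) := by
  obtain ⟨d, h⟩ := h
  obtain ⟨h1, h2⟩ := nilpotent_bounds F h
  exact ⟨⟨d + 1, Nat.le_add_left 1 d, h1.le⟩, fun G _ f hf hfK =>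
    Subgroup.nilpotent_iff_lowerCentralSeries.2 ⟨d, h2 G f hf hfK⟩⟩

theorem Frame.of_nilpotent_structure {G : Type u} [Group G] (F : Frame K G)
    (h : IsNilpotentExtension K ∧ SubgroupsSatisfy K (fun G _ => Group.IsNilpotent G)) :
    LeftNilpotent S ∧ RightNilpotent S ∧ Supernilpotent S := by
  obtain ⟨⟨m, hm, hmK⟩, hG⟩ := h
  obtain ⟨n, hn⟩ := Subgroup.nilpotent_iff_lowerCentralSeries.1
    (hG G F.ι F.ι_injective (Set.range_subset_iff.2 F.ι_mem))
  exact ⟨⟨_, F.leftNilpotentOfClass hm hmK hn⟩, ⟨_, F.rightNilpotentOfClass hm hmK hn⟩,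
    ⟨_, F.supernilpotentOfClass hm (Nat.le_add_left 1 n) hmK
      (le_bot_iff.1 (hn ▸ Subgroup.lowerCentralSeries_antitone _ (Nat.le_succ n)))⟩⟩

end Classification

end TermCondition

theorem theorem1p1 {S : Type u} [Semigroup S] (K : Subsemigroup S)
    (hK : TermCondition.IsIdeal (K : Set S)) (hcs : TermCondition.IsCompletelySimple K) :
    -- the characterization of solvability
    (TermCondition.Solvable S ↔
      TermCondition.IsNilpotentExtension K ∧
        TermCondition.SubgroupsSatisfy K (fun G _ => Group.IsSolvable G)) ∧
    -- the characterization of left and right nilpotence and of supernilpotence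
    (TermCondition.LeftNilpotent S ↔ TermCondition.RightNilpotent S) ∧
    (TermCondition.RightNilpotent S ↔ TermCondition.Supernilpotent S) ∧
    (TermCondition.Supernilpotent S ↔
      TermCondition.IsNilpotentExtension K ∧
        TermCondition.SubgroupsSatisfy K (fun G _ => Group.IsNilpotent G)) ∧
    -- class bounds, from `S` to `K` and its subgroups
    (∀ d : ℕ, TermCondition.SolvableOfClass S d →
      TermCondition.power S (2 ^ d) = K ∧
        TermCondition.SubgroupsSatisfy K (fun G _ => derivedSeries G d = ⊥)) ∧
    (∀ d : ℕ, (TermCondition.LeftNilpotentOfClass S d ∨ TermCondition.RightNilpotentOfClass S d ∨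
        TermCondition.SupernilpotentOfClass S d) →
      TermCondition.power S (d + 1) = K ∧
        TermCondition.SubgroupsSatisfy K (fun G _ => (⊤ : Subgroup G).lowerCentralSeries d = ⊥)) ∧
    -- class bounds, from `K` and its subgroups to `S`
    (∀ m n : ℕ, 1 ≤ m → TermCondition.power S m = K →
      TermCondition.SubgroupsSatisfy K (fun G _ => derivedSeries G n = ⊥) →
        TermCondition.SolvableOfClass S (Nat.clog 2 m + n + 1)) ∧
    (∀ m n : ℕ, 1 ≤ m → TermCondition.power S m = K →
      TermCondition.SubgroupsSatisfy K (fun G _ => (⊤ : Subgroup G).lowerCentralSeries n = ⊥) →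
        TermCondition.LeftNilpotentOfClass S (2 * m + n) ∧
        TermCondition.RightNilpotentOfClass S (2 * m + n) ∧
        TermCondition.SupernilpotentOfClass S (2 * m * max n 1)) := by
  obtain ⟨G, _, ⟨F⟩⟩ := TermCondition.exists_frame K hK hcs
  have hrange : Set.range F.ι ⊆ K := Set.range_subset_iff.2 F.ι_mem
  refine ⟨⟨?_, ?_⟩, ⟨?_, ?_⟩, ⟨?_, ?_⟩, ⟨?_, ?_⟩, fun d h => h.bounds F,
    fun d h => TermCondition.nilpotent_bounds F h, ?_, ?_⟩
  · rintro ⟨d, h⟩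
    obtain ⟨h1, h2⟩ := h.bounds F
    exact ⟨⟨2 ^ d, Nat.one_le_two_pow, h1.le⟩, fun G _ f hf hfK => ⟨⟨d, h2 G f hf hfK⟩⟩⟩
  · rintro ⟨⟨m, -, hmK⟩, hG⟩
    obtain ⟨n, hn⟩ := (hG G F.ι F.ι_injective hrange).solvable
    exact ⟨_, F.solvableOfClass hmK hn⟩
  · rintro ⟨d, h⟩
    exact (F.of_nilpotent_structure
      (TermCondition.nilpotent_structure F ⟨d, Or.inl h⟩)).2.1
  · rintro ⟨d, h⟩
    exact (F.of_nilpotent_structure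
      (TermCondition.nilpotent_structure F ⟨d, Or.inr (Or.inl h)⟩)).1
  · rintro ⟨d, h⟩
    exact (F.of_nilpotent_structure
      (TermCondition.nilpotent_structure F ⟨d, Or.inr (Or.inl h)⟩)).2.2
  · rintro ⟨d, h⟩
    exact (F.of_nilpotent_structure
      (TermCondition.nilpotent_structure F ⟨d, Or.inr (Or.inr h)⟩)).2.1
  · rintro ⟨d, h⟩
    exact TermCondition.nilpotent_structure F ⟨d, Or.inr (Or.inr h)⟩
  · exact fun h => (F.of_nilpotent_structure h).2.2
  · intro m n _ hmK hG
    exact F.solvableOfClass hmK.le (hG G F.ι F.ι_injective hrange)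
  · intro m n hm hmK hG
    have hn := hG G F.ι F.ι_injective hrange
    exact ⟨F.leftNilpotentOfClass hm hmK.le hn, F.rightNilpotentOfClass hm hmK.le hn,
      -- Positivity of the class keeps the cube dimension above m even when G is trivial, as the
      -- missing-coordinate argument requires.
      F.supernilpotentOfClass hm (le_max_right n 1) hmK.le
        (le_bot_iff.1 (hn ▸ Subgroup.lowerCentralSeries_antitone _ (le_max_left n 1)))⟩
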